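/- A caterpillar with $n\ge 1$ spine vertices and $m$ leg vertices is a tree $G$ that consists of a path $s_1,\dots,s_n$ (the spine) and, for each $i$, of $m_i\ge 0$ further vertices (legs) adjacent to $s_i$ only; here $m=m_1+\dots+m_n$. Let $$H(G)=\sum_{i:\,m_i>0}\frac{m_i}{m}\log\frac{m}{m_i}$$ be the Shannon entropy of the leg distribution ($H(G)=0$ if $m=0$). A search tree on a connected graph $G$ is a rooted tree with node set $V(G)$, defined recursively: its root is some vertex $r$, and the subtrees of the children of $r$ are search trees on the connected components of $G\setminus r$, one for each component. Rotating an edge $(p,c)$ of a search tree $T$, where $c$ is a child of $p$, puts $c$ in the place of $p$, makes $p$ a child of $c$, and makes a child of $p$ each child $x$ of $c$ whose subtree contains both a vertex adjacent to $p$ and a vertex adjacent to $c$; all other nodes keep their parents. Let $\delta(\mathcal A(G))$, the diameter of the associahedron $\mathcal A(G)$, be the maximum, over all pairs of search trees on $G$, of the minimum number of rotations that transform one into the other. Theorem. There are constants $c,C>0$ such that for every caterpillar $G$ with $n\ge 1$ spine vertices and $m$ leg vertices, the diameter $\delta(\mathcal A(G))$ is finite and $$\delta(\mathcal A(G))\le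 C\,\bigl(n+m\,(H(G)+1)\bigr),$$ and, if $G$ has at least two vertices (that is, $n+m\ge 2$), also $$\delta(\mathcal A(G))\ge c\,\bigl(n+m\,(H(G)+1)\bigr).$$ In other words, $\delta(\mathcal A(G))\in\Theta\bigl(n+m\,(H(G)+1)\bigr)$. -/

import Mathlib

/-- A rooted tree with node set `V`, given by its root and its parent function: the root is the
only node without a parent, and every node is reached from the root by going to children. -/
structure RootedTreeOn (V : Type*) where
  root : V
  parent : V → Option V
  parent_eq_none_iff : ∀ x, parent x = none ↔ x = root
  root_reaches : ∀ x, Relation.ReflTransGen (fun a b => parent b = some a) root x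

namespace RootedTreeOn

variable {V : Type*}

/-- `V(T_x)`: the node set of the subtree consisting of `x` and all its descendants. -/
def subtree (T : RootedTreeOn V) (x : V) : Set V :=
  {y | Relation.ReflTransGen (fun a b => T.parent b = some a) x y}

/-- The set of children of the node `x`. -/
def children (T : RootedTreeOn V) (x : V) : Set V :=
  {c | T.parent c = some x}

end RootedTreeOn

namespace SimpleGraph

variable {V : Type*}

/-- The vertex sets of the connected components of the induced subgraph `G[U]`. -/
def componentsOn (G : SimpleGraph V) (U : Set V) : Set (Set V) :=
  {C | ∃ K : (G.induce U).ConnectedComponent, C = Subtype.val '' K.supp}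

/-- A search tree on the (connected) graph `G`. The recursion "remove the root `r`; the subtrees
of the children of `r` are search trees on the connected components of `G \ r`" is unrolled: it
says that for each node `x`, the vertex sets `V(T_c)`, for the children `c` of `x`, are precisely
the connected components of `G[V(T_x)] \ x`. -/
structure SearchTree (G : SimpleGraph V) extends RootedTreeOn V where
  subtrees_eq_components : ∀ x,
    toRootedTreeOn.subtree '' toRootedTreeOn.children x =
      G.componentsOn (toRootedTreeOn.subtree x \ {x})

namespace SearchTree

variable {G : SimpleGraph V}

/-- `T'` is obtained from `T` by rotating the edge `(p, c)`, where `c` is a child of `p` in `T`: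
`c` takes the place of `p`, `p` becomes a child of `c`, each child `x` of `c` such that `V(T_x)`
contains both a vertex adjacent to `p` and a vertex adjacent to `c` becomes a child of `p`, and
all other nodes keep their parents. -/
def IsRotation (T : G.SearchTree) (p c : V) (T' : G.SearchTree) : Prop :=
  T.parent c = some p ∧
  T'.parent c = T.parent p ∧
  T'.parent p = some c ∧
  ∀ x, x ≠ p → x ≠ c →
    ((T.parent x = some c ∧ (∃ u ∈ T.subtree x, G.Adj u p) ∧ (∃ u ∈ T.subtree x, G.Adj u c)) →
      T'.parent x = some p) ∧
    (¬ (T.parent x = some c ∧ (∃ u ∈ T.subtree x, G.Adj u p) ∧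
        (∃ u ∈ T.subtree x, G.Adj u c)) →
      T'.parent x = T.parent x)

end SearchTree

/-- The rotation graph of the search trees on `G`: two search trees are adjacent if one is obtained
from the other by a rotation (a rotation of `(p, c)` is undone by the rotation of `(c, p)`). -/
def rotationGraph (G : SimpleGraph V) : SimpleGraph G.SearchTree :=
  SimpleGraph.fromRel fun T T' => ∃ p c, T.IsRotation p c T'

end SimpleGraph

/-- The caterpillar `C(m₁, …, mₙ)`. Its vertices are the spine vertices `inl i` and the leg
vertices `inr ⟨i, j⟩` with `j < m i`; the spine is a path, in the order of the indices, and the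
leg `⟨i, j⟩` is adjacent to the spine vertex `i` only. -/
def caterpillar {n : ℕ} (m : Fin n → ℕ) : SimpleGraph (Fin n ⊕ (i : Fin n) × Fin (m i)) :=
  SimpleGraph.fromRel fun u v =>
    match u, v with
    | Sum.inl i, Sum.inl j => (i : ℕ) + 1 = j
    | Sum.inl i, Sum.inr l => i = l.1
    | _, _ => False

/-- The Shannon entropy `H(m₁, …, mₙ) = ∑_{i, mᵢ > 0} (mᵢ / m) log (m / mᵢ)`, `m = m₁ + ⋯ + mₙ`. -/
noncomputable def legEntropy {n : ℕ} (m : Fin n → ℕ) : ℝ :=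
  ∑ i with 0 < m i, ((m i : ℝ) / (∑ j, m j : ℕ)) * Real.log ((∑ j, m j : ℕ) / (m i : ℝ))

/-! Both bounds are measured against one reference tree on the spine indices, built in
`exists_refTree`: its root is a weighted median of the leg distribution, and both sides are treated
recursively. By the grouping rule, m·H(G) is a sum over its nodes; a node with a and b legs on its
two sides, c legs at its own index and w = a + b + c contributes w log w − a log a − b log b − c log
c. As a, b ≤ w/2, this is at least (a + b) log 2, and it is at most w log 3 ≤ 2 log 3 · (min(a, b) +
c). Hence the sum of the w (`totalWeight`) is O(m(H + 1)), and m plus the sum of the min(a, b)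
(`score`) is Ω(mH).

Upper bound. Any search tree is brought to one canonical tree, the increasing path of spine vertices
with all legs as leaves. The root of the reference tree is rotated to the top, then both sides are
handled recursively. A pivot costs its depth: explicit legs and spine vertices with legs number at
most 2w in the subtree, and the spine vertices without legs are amortized
(`Valid.exists_reach_root`) to O(n) overall. When no leg is above its spine vertex any more, at most
n rotations straighten the spine.

Lower bound. Three potentials change by O(1) per rotation: the number of spine vertices on the
rightmost path gives n, the number of legs above their spine vertex gives m, and an alternation
bound in the manner of Wilber gives the entropy. For each reference node, the search path towards
its index is read as a word of sides, restricted to the node's interval, and the blocks of the word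
are counted. A rotation of (p, c) affects at most the one reference node that separates p from c,
where it exchanges two adjacent letters (`Step.runSum_le`). The canonical path has at most two
blocks per node, whereas removing all legs first, in an order that alternates at every reference
node simultaneously, gives at least `score` blocks (`score_le_runSum`).

The combinatorics takes place in the inductive type `CTree`. The bridge is that a search tree is
determined by its descendant sets, and that a rotation is a symmetric exchange of these
(`SubtreesSwap`). -/

/-! ### Rooted trees and their descendant sets. -/

namespace RootedTreeOn

variable {V : Type*} (T : RootedTreeOn V)

theorem self_mem_subtree (x : V) : x ∈ T.subtree x := Relation.ReflTransGen.refl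

variable {T}

theorem subtree_subset {x y : V} (h : y ∈ T.subtree x) : T.subtree y ⊆ T.subtree x :=
  fun _ hz => Relation.ReflTransGen.trans h hz

theorem mem_subtree_of_parent {x y : V} (h : T.parent y = some x) : y ∈ T.subtree x :=
  Relation.ReflTransGen.single h

theorem subtree_root : T.subtree T.root = Set.univ :=
  Set.eq_univ_of_forall T.root_reaches

theorem parent_mem_subtree {x y p : V} (h : y ∈ T.subtree x) (hne : y ≠ x)
    (hp : T.parent y = some p) : p ∈ T.subtree x := by
  rcases Relation.ReflTransGen.cases_tail h with h | ⟨q, hq, hqy⟩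
  · exact absurd h hne
  · obtain rfl : q = p := by rw [hp] at hqy; exact (Option.some.inj hqy).symm
    exact hq

theorem mem_subtree_antisymm {x y : V} (hxy : x ∈ T.subtree y) (hyx : y ∈ T.subtree x) :
    x = y := by
  -- Parents are unique, so a cycle through a node also passes through its parent; it would climb to
  -- the root, which has no parent.
  have acyc : ∀ z, ¬ Relation.TransGen (fun a b => T.parent b = some a) z z := by
    intro z
    refine Relation.ReflTransGen.head_induction_on
      (motive := fun a _ => ¬ Relation.TransGen (fun a b => T.parent b = some a) a a)
      (r := Function.swap (fun a b => T.parent b = some a)) (b := T.root)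
      (Relation.reflTransGen_swap.2 (T.root_reaches z)) ?_ ?_
    · intro h
      obtain ⟨q, -, hq⟩ := Relation.TransGen.tail'_iff.1 h
      rw [(T.parent_eq_none_iff _).2 rfl] at hq
      cases hq
    · intro w u hwu _ ih h
      obtain ⟨q, hq, hqw⟩ := Relation.TransGen.tail'_iff.1 h
      have hwu' : T.parent w = some u := hwu
      obtain rfl : u = q := by rw [hwu'] at hqw; exact Option.some.inj hqw
      exact ih (Relation.TransGen.head' hwu' hq)
  by_contra hne
  rcases Relation.reflTransGen_iff_eq_or_transGen.1 hxy with h | h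
  · exact hne h
  · exact acyc _ (h.trans_left hyx)

theorem mem_subtree_total {x y z : V} (hx : z ∈ T.subtree x) (hy : z ∈ T.subtree y) :
    x ∈ T.subtree y ∨ y ∈ T.subtree x := by
  have U : Relator.RightUnique (Function.swap fun a b => T.parent b = some a) := by
    intro a b c hb hc
    have hb' : T.parent a = some b := hb
    have hc' : T.parent a = some c := hc
    rw [hb'] at hc'
    exact Option.some.inj hc'
  rcases Relation.ReflTransGen.total_of_right_unique U (Relation.reflTransGen_swap.2 hx)
    (Relation.reflTransGen_swap.2 hy) with h | h
  · exact Or.inl (Relation.reflTransGen_swap.1 h)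
  · exact Or.inr (Relation.reflTransGen_swap.1 h)

theorem ne_of_parent {x p : V} (h : T.parent x = some p) : x ≠ p := by
  rintro rfl
  have hr := T.root_reaches x
  have : ∀ z, Relation.ReflTransGen (fun a b => T.parent b = some a) z x → z = x := by
    intro z hz
    refine Relation.ReflTransGen.head_induction_on (motive := fun a _ => a = x) hz rfl ?_
    intro a c hac _ hc
    subst hc
    rw [h] at hac
    exact (Option.some.inj hac).symm
  have := this _ hr
  rw [(T.parent_eq_none_iff x).2 this.symm] at h
  cases h

/-- The parent is the least proper ancestor, so it can be read off from the descendant sets alone.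
This is what makes those sets determine the tree. -/
theorem parent_eq_some_iff {x p : V} : T.parent x = some p ↔
    x ∈ T.subtree p ∧ x ≠ p ∧ ∀ y, x ∈ T.subtree y → y ≠ x → p ∈ T.subtree y := by
  constructor
  · intro h
    exact ⟨mem_subtree_of_parent h, ne_of_parent h,
      fun y hy hne => parent_mem_subtree hy hne.symm h⟩
  · rintro ⟨h1, h2, h3⟩
    rcases hq : T.parent x with _ | q
    · have := (T.parent_eq_none_iff x).1 hq
      subst this
      exact absurd (mem_subtree_antisymm h1 (T.root_reaches p)) h2
    · have hpq : q ∈ T.subtree p := parent_mem_subtree h1 h2 hq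
      have hqp := h3 q (mem_subtree_of_parent hq) (ne_of_parent hq).symm
      rw [mem_subtree_antisymm hpq hqp]

theorem exists_parent {x y : V} (h : x ∈ T.subtree y) (hne : x ≠ y) :
    ∃ p, T.parent x = some p := by
  rcases hq : T.parent x with _ | q
  · have := (T.parent_eq_none_iff x).1 hq
    subst this
    exact absurd (mem_subtree_antisymm h (T.root_reaches y)) hne
  · exact ⟨q, rfl⟩

theorem exists_child {x y : V} (h : x ∈ T.subtree y) (hne : x ≠ y) :
    ∃ c, T.parent c = some y ∧ x ∈ T.subtree c := by
  rcases Relation.ReflTransGen.cases_head h with h | ⟨q, hq, hqy⟩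
  · exact absurd h.symm hne
  · exact ⟨q, hq, hqy⟩

theorem parent_eq_none_iff_subtree {x : V} : T.parent x = none ↔ T.subtree x = Set.univ := by
  rw [T.parent_eq_none_iff]
  constructor
  · rintro rfl; exact subtree_root
  · intro h
    exact mem_subtree_antisymm (T.root_reaches x) (h ▸ Set.mem_univ _)

theorem ext_parent {T T' : RootedTreeOn V} (h : T.parent = T'.parent) : T = T' := by
  have hr : T.root = T'.root := by
    rw [← T'.parent_eq_none_iff, ← h, T.parent_eq_none_iff]
  cases T; cases T'
  simp only at h hr
  subst h hr
  rfl

theorem ext_subtree {T T' : RootedTreeOn V} (h : ∀ x, T.subtree x = T'.subtree x) : T = T' := by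
  apply ext_parent
  funext x
  apply Option.ext
  intro p
  rw [parent_eq_some_iff, parent_eq_some_iff]
  simp only [h]

end RootedTreeOn

/-! ### Search trees on general graphs: descendant sets, rotations as exchanges, construction from
laminar families. -/

namespace SimpleGraph

variable {V : Type*} {G : SimpleGraph V}

/-- A test by connectedness and closure that avoids the quotient type: a walk in `G[U]` cannot leave
a closed set. -/
theorem mem_componentsOn_iff {U C : Set V} : C ∈ G.componentsOn U ↔
    C.Nonempty ∧ C ⊆ U ∧ (G.induce C).Preconnected ∧
      ∀ u ∈ C, ∀ v ∈ U, G.Adj u v → v ∈ C := by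
  constructor
  · rintro ⟨K, rfl⟩
    refine ⟨K.nonempty_supp.image _, ?_, ?_, ?_⟩
    · rintro _ ⟨x, -, rfl⟩; exact x.2
    · have hK := K.connected_toSimpleGraph.preconnected
      refine hK.map (f := ⟨fun x => ⟨x.1.1, x.1, x.2, rfl⟩, ?_⟩) ?_
      · intro a b hab
        exact hab
      · rintro ⟨_, x, hx, rfl⟩
        exact ⟨⟨x, hx⟩, rfl⟩
    · rintro _ ⟨x, hx, rfl⟩ v hv hadj
      refine ⟨⟨v, hv⟩, ?_, rfl⟩
      rw [ConnectedComponent.mem_supp_iff] at hx ⊢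
      rw [← hx]
      exact ConnectedComponent.sound
        (Adj.reachable (G := G.induce U) (u := ⟨v, hv⟩) (v := x) hadj.symm)
  · rintro ⟨⟨u, hu⟩, hCU, hconn, hclosed⟩
    refine ⟨(G.induce U).connectedComponentMk ⟨u, hCU hu⟩, ?_⟩
    ext v
    constructor
    · intro hv
      refine ⟨⟨v, hCU hv⟩, ?_, rfl⟩
      rw [ConnectedComponent.mem_supp_iff]
      apply ConnectedComponent.sound
      exact (hconn ⟨v, hv⟩ ⟨u, hu⟩).map (induceHomOfLE G hCU).toHom
    · rintro ⟨w, hw, rfl⟩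
      rw [ConnectedComponent.mem_supp_iff] at hw
      have hw' := (ConnectedComponent.exact hw).symm
      rw [reachable_iff_reflTransGen] at hw'
      induction hw' with
      | refl => exact hu
      | tail _ hab ih =>
        rename_i b c hub
        have : b.1 ∈ C :=
          ih (ConnectedComponent.sound ((reachable_iff_reflTransGen _ _).2 hub).symm)
        exact hclosed _ this _ c.2 hab

theorem componentsOn_eq_of_mem {U C C' : Set V} (h : C ∈ G.componentsOn U)
    (h' : C' ∈ G.componentsOn U) {u : V} (hu : u ∈ C) (hu' : u ∈ C') : C = C' := by
  obtain ⟨K, rfl⟩ := h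
  obtain ⟨K', rfl⟩ := h'
  obtain ⟨x, hx, rfl⟩ := hu
  obtain ⟨y, hy, hxy⟩ := hu'
  obtain rfl : y = x := Subtype.ext hxy
  rw [ConnectedComponent.mem_supp_iff] at hx hy
  rw [← hx, ← hy]

namespace SearchTree

open RootedTreeOn

variable {T T' : G.SearchTree}

theorem ext_subtree (h : ∀ x, T.subtree x = T'.subtree x) : T = T' := by
  have := RootedTreeOn.ext_subtree h
  cases T; cases T'
  simp only at this
  subst this
  rfl

theorem subtree_mem_componentsOn {x c : V} (h : T.parent c = some x) :
    T.subtree c ∈ G.componentsOn (T.subtree x \ {x}) := by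
  rw [← T.subtrees_eq_components]
  exact ⟨c, h, rfl⟩

theorem exists_child_subtree_eq {x : V} {C : Set V}
    (h : C ∈ G.componentsOn (T.subtree x \ {x})) :
    ∃ c, T.parent c = some x ∧ T.subtree c = C := by
  rw [← T.subtrees_eq_components] at h
  exact h

/-- Removing a node separates no adjacent pair unless the node is one of the two. So on the way from
the root down to `u`, the subtrees keep `v` until `v` itself is removed. -/
theorem mem_subtree_or_of_adj {u v : V} (h : G.Adj u v) :
    u ∈ T.subtree v ∨ v ∈ T.subtree u := by
  by_contra! hcon
  obtain ⟨hu, hv⟩ := hcon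
  apply hv
  have hr := T.root_reaches u
  have key : ∀ y, Relation.ReflTransGen (fun a b => T.parent b = some a) T.root y →
      u ∈ T.subtree y → v ∈ T.subtree y := by
    intro y hy
    induction hy with
    | refl => intro _; exact T.root_reaches v
    | tail _ hab ih =>
      rename_i a b _
      intro hub
      have hua := subtree_subset (mem_subtree_of_parent hab) hub
      have hva := ih hua
      have hC := mem_componentsOn_iff.1 (subtree_mem_componentsOn hab)
      refine hC.2.2.2 u hub v ⟨hva, ?_⟩ h
      rintro rfl
      exact hu hua
  exact key u hr (T.self_mem_subtree u)

theorem subtree_preconnected (hG : G.Preconnected) (x : V) :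
    (G.induce (T.subtree x)).Preconnected := by
  rcases hp : T.parent x with _ | p
  · rw [parent_eq_none_iff_subtree.1 hp]
    refine hG.map (f := ⟨fun x => ⟨x, trivial⟩, ?_⟩) ?_
    · intro a b hab; exact hab
    · rintro ⟨x, hx⟩; exact ⟨x, rfl⟩
  · exact (mem_componentsOn_iff.1 (subtree_mem_componentsOn hp)).2.2.1

theorem exists_adj_of_parent (hG : G.Preconnected) {x p : V} (h : T.parent x = some p) :
    ∃ u ∈ T.subtree x, G.Adj u p := by
  by_contra! hcon
  have hx := mem_componentsOn_iff.1 (subtree_mem_componentsOn h)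
  have hconn := T.subtree_preconnected hG p
  have hreach := hconn ⟨x, mem_subtree_of_parent h⟩ ⟨p, T.self_mem_subtree p⟩
  rw [reachable_iff_reflTransGen] at hreach
  have key : ∀ y : T.subtree p, Relation.ReflTransGen (G.induce (T.subtree p)).Adj
      ⟨x, mem_subtree_of_parent h⟩ y → y.1 ∈ T.subtree x := by
    intro y hy
    induction hy with
    | refl => exact T.self_mem_subtree x
    | tail _ hab ih =>
      rename_i a b _
      have hab' : G.Adj a.1 b.1 := hab
      refine hx.2.2.2 a.1 ih b.1 ⟨b.2, ?_⟩ hab'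
      intro hb
      have hb' : b.1 = p := hb
      exact hcon a.1 ih ((congrArg (G.Adj a.1) hb').mp hab')
  exact (hx.2.1 (key _ hreach)).2 rfl

/-- Search trees whose subtrees agree up to exchanging the roles of `p` and `c` at the top. -/
def SubtreesSwap (T : G.SearchTree) (p c : V) (T' : G.SearchTree) : Prop :=
  p ≠ c ∧ T.subtree p = T'.subtree c ∧ ∀ x, x ≠ p → x ≠ c → T.subtree x = T'.subtree x

theorem SubtreesSwap.symm {p c : V} (h : SubtreesSwap T p c T') : SubtreesSwap T' c p T :=
  ⟨h.1.symm, h.2.1.symm, fun x h1 h2 => (h.2.2 x h2 h1).symm⟩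

theorem SubtreesSwap.parent_eq {p c : V} (h : SubtreesSwap T p c T') : T.parent c = some p := by
  obtain ⟨hne, hpc, heq⟩ := h
  have hc : c ∈ T.subtree p := hpc ▸ T'.self_mem_subtree c
  obtain ⟨y, hy⟩ := exists_parent hc hne.symm
  by_cases hyp : y = p
  · rw [hy, hyp]
  · have hyc := (ne_of_parent hy).symm
    have h1 : c ∈ T'.subtree y := by
      rw [← heq y hyp hyc]; exact mem_subtree_of_parent hy
    have h2 : y ∈ T'.subtree c := by
      rw [← hpc]; exact parent_mem_subtree hc hne.symm hy
    exact absurd (mem_subtree_antisymm h2 h1) hyc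

/-- Parents are recovered as least proper ancestors. Connectedness of `G` makes the subtree of every
child touch its parent, so a child of `c` that ends up below `p` has neighbours of both. -/
theorem SubtreesSwap.isRotation (hG : G.Preconnected) {p c : V} (h : SubtreesSwap T p c T') :
    T.IsRotation p c T' := by
  have hTc := h.parent_eq
  have hTp := h.symm.parent_eq
  obtain ⟨hne, hpc, heq⟩ := h
  have up : ∀ {x z y : V}, T.parent x = some y → z ≠ x → z ≠ p → z ≠ c → x ∈ T'.subtree z →
      y ∈ T.subtree z := by
    intro x z y hxy hzx hzp hzc hx
    rw [← heq z hzp hzc] at hx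
    exact parent_mem_subtree hx hzx.symm hxy
  refine ⟨hTc, ?_, hTp, ?_⟩
  · rcases hg : T.parent p with _ | g
    · rw [parent_eq_none_iff_subtree] at hg ⊢
      rw [← hpc, hg]
    · have hgp := (ne_of_parent hg).symm
      have hpg := mem_subtree_of_parent hg
      have hcg : c ∈ T.subtree g := subtree_subset hpg (mem_subtree_of_parent hTc)
      have hgc : g ≠ c := by
        rintro rfl
        exact hgp (mem_subtree_antisymm (mem_subtree_of_parent hTc) hpg)
      rw [parent_eq_some_iff, ← heq g hgp hgc]
      refine ⟨hcg, hgc.symm, fun y hy hyc => ?_⟩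
      have hyp : y ≠ p := by
        rintro rfl
        exact hne (mem_subtree_antisymm (mem_subtree_of_parent hTp) hy)
      rw [← heq y hyp hyc] at hy ⊢
      exact parent_mem_subtree (parent_mem_subtree hy hyc.symm hTc) hyp.symm hg
  · intro x hxp hxc
    have hx := heq x hxp hxc
    -- The neighbour `u` is comparable with `p` in `T'`; since `p` is not below `x`, it must be
    -- above it.
    have mem_p_of_adj : p ∉ T.subtree x → (∃ u ∈ T.subtree x, G.Adj u p) → x ∈ T'.subtree p := by
      rintro hpx ⟨u, hu, hup⟩
      rw [hx] at hu hpx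
      rcases T'.mem_subtree_or_of_adj hup with h1 | h1
      · rcases mem_subtree_total hu h1 with h2 | h2
        · exact h2
        · exact absurd h2 hpx
      · exact absurd (subtree_subset hu h1) hpx
    constructor
    · rintro ⟨hxc', hadj, -⟩
      have hxsc := mem_subtree_of_parent hxc'
      have hcp := mem_subtree_of_parent hTc
      have hpx : p ∉ T.subtree x := fun h1 =>
        hxp (mem_subtree_antisymm (subtree_subset hcp hxsc) h1)
      have hxp' := mem_p_of_adj hpx hadj
      refine parent_eq_some_iff.2 ⟨hxp', hxp, fun y hy hyx => ?_⟩
      by_cases hyp : y = p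
      · subst hyp; exact T'.self_mem_subtree _
      by_cases hyc : y = c
      · subst hyc; exact mem_subtree_of_parent hTp
      have := up hxc' hyx hyp hyc hy
      rw [← heq y hyp hyc]
      exact parent_mem_subtree this (Ne.symm hyc) hTc
    · intro hmove
      rcases hy : T.parent x with _ | y
      · rw [parent_eq_none_iff_subtree] at hy ⊢
        rw [← hx, hy]
      obtain ⟨z, hz⟩ : ∃ z, T'.parent x = some z := by
        rcases hz : T'.parent x with _ | z
        · rw [parent_eq_none_iff_subtree, ← hx, ← parent_eq_none_iff_subtree, hy] at hz
          cases hz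
        · exact ⟨z, rfl⟩
      have hxz := mem_subtree_of_parent hz
      have hxy := mem_subtree_of_parent hy
      have hzx := (ne_of_parent hz).symm
      have hyx := (ne_of_parent hy).symm
      rw [hz]
      congr 1
      by_cases hyp : y = p
      · subst hyp
        have hxc' : x ∈ T'.subtree c := hpc ▸ hxy
        have hpx : y ∉ T.subtree x := fun h1 => hxp (mem_subtree_antisymm hxy h1)
        have h1 := mem_p_of_adj hpx (T.exists_adj_of_parent hG hy)
        by_contra hzy
        have hzc : z ≠ c := by
          rintro rfl
          have h2 := parent_mem_subtree h1 hxp hz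
          exact hne (mem_subtree_antisymm (mem_subtree_of_parent hTp) h2)
        have h2 := up hy hzx hzy hzc hxz
        have h3 : z ∈ T.subtree y := hpc ▸ parent_mem_subtree hxc' hxc hz
        exact hzy (mem_subtree_antisymm h3 h2)
      by_cases hyc : y = c
      · subst hyc
        have hxc' : x ∈ T'.subtree y :=
          hpc ▸ subtree_subset (mem_subtree_of_parent hTc) hxy
        by_contra hzy
        by_cases hzp : z = p
        · subst hzp
          refine hmove ⟨hy, ?_, T.exists_adj_of_parent hG hy⟩
          rw [hx]
          exact T'.exists_adj_of_parent hG hz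
        · have h2 := parent_mem_subtree (up hy hzx hzp hzy hxz) (Ne.symm hzy) hTc
          have h3 : z ∈ T.subtree p := hpc ▸ parent_mem_subtree hxc' hxc hz
          exact hzp (mem_subtree_antisymm h3 h2)
      have hxy' : x ∈ T'.subtree y := heq y hyp hyc ▸ hxy
      have hzy' : z ∈ T'.subtree y := parent_mem_subtree hxy' hyx.symm hz
      have hzp_or : x ∈ T.subtree p → z ≠ p ∧ z ≠ c := by
        intro h1
        have h2 := parent_mem_subtree h1 hxp hy
        constructor
        · rintro rfl
          rw [← heq y hyp hyc] at hzy'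
          exact hyp (mem_subtree_antisymm h2 hzy')
        · rintro rfl
          rw [hpc] at h2
          exact hyc (mem_subtree_antisymm h2 hzy')
      have hzpc : z ≠ p ∧ z ≠ c := by
        by_cases h1 : x ∈ T.subtree p
        · exact hzp_or h1
        · constructor
          · rintro rfl
            exact absurd (hpc ▸ subtree_subset (mem_subtree_of_parent hTp) hxz) h1
          · rintro rfl
            exact absurd (hpc ▸ hxz) h1
      have h1 := up hy hzx hzpc.1 hzpc.2 hxz
      rw [← heq y hyp hyc] at hzy'
      exact mem_subtree_antisymm hzy' h1

theorem IsRotation.unique {T₁ T₂ : G.SearchTree} {p c : V} (h₁ : T.IsRotation p c T₁)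
    (h₂ : T.IsRotation p c T₂) : T₁ = T₂ := by
  have hpar : T₁.parent = T₂.parent := by
    funext x
    by_cases hxp : x = p
    · rw [hxp, h₁.2.2.1, h₂.2.2.1]
    by_cases hxc : x = c
    · rw [hxc, h₁.2.1, h₂.2.1]
    by_cases hm : T.parent x = some c ∧ (∃ u ∈ T.subtree x, G.Adj u p) ∧
        (∃ u ∈ T.subtree x, G.Adj u c)
    · rw [(h₁.2.2.2 x hxp hxc).1 hm, (h₂.2.2.2 x hxp hxc).1 hm]
    · rw [(h₁.2.2.2 x hxp hxc).2 hm, (h₂.2.2.2 x hxp hxc).2 hm]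
  have := RootedTreeOn.ext_parent hpar
  cases T₁; cases T₂
  simp only at this
  subst this
  rfl

/-- A laminar family `D` of connected vertex sets, indexed by the vertices, in which adjacent
vertices are comparable, is the family of subtrees of a search tree. -/
theorem exists_subtree_eq [Finite V] (D : V → Set V) (hself : ∀ x, x ∈ D x)
    (htrans : ∀ x y, y ∈ D x → D y ⊆ D x) (hanti : ∀ x y, x ∈ D y → y ∈ D x → x = y)
    (htotal : ∀ x y z, z ∈ D x → z ∈ D y → x ∈ D y ∨ y ∈ D x) (r : V) (hr : D r = Set.univ)
    (hconn : ∀ x, (G.induce (D x)).Preconnected)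
    (hadj : ∀ u v, G.Adj u v → u ∈ D v ∨ v ∈ D u) :
    ∃ T : G.SearchTree, ∀ x, T.subtree x = D x := by
  have hpar : ∀ x, ∃ q : Option V, (q = none ↔ x = r) ∧ ∀ p, q = some p →
      x ∈ D p ∧ x ≠ p ∧ ∀ y, x ∈ D y → y ≠ x → p ∈ D y := by
    intro x
    by_cases hx : x = r
    · exact ⟨none, by simp [hx], by simp⟩
    · have hne : {y | x ∈ D y ∧ y ≠ x}.Nonempty :=
        ⟨r, by rw [Set.mem_ofPred_eq, hr]; exact ⟨trivial, Ne.symm hx⟩⟩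
      -- The parent is the index of a smallest other member containing `x`; by comparability it is
      -- also least under inclusion.
      obtain ⟨p, hp, hmin⟩ := Set.exists_min_image _ (fun y => (D y).ncard) (Set.toFinite _) hne
      refine ⟨some p, by simp [hx], ?_⟩
      rintro p' h
      obtain rfl := Option.some.inj h
      refine ⟨hp.1, hp.2.symm, fun y hy hyx => ?_⟩
      rcases htotal _ _ _ hp.1 hy with h1 | h1
      · exact h1
      · have h2 := hmin y ⟨hy, hyx⟩
        have h3 := Set.eq_of_subset_of_ncard_le (htrans _ _ h1) h2 (Set.toFinite _)
        rw [h3]; exact hself p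
  choose par hroot hpar using hpar
  have hreach : ∀ (k : ℕ) (x y : V), (D x).ncard ≤ k → y ∈ D x →
      Relation.ReflTransGen (fun a b => par b = some a) x y := by
    -- The measure drops when `y` is replaced by its parent, whose set is strictly larger.
    have : ∀ (k : ℕ) (x y : V), (D x).ncard - (D y).ncard ≤ k → y ∈ D x →
      Relation.ReflTransGen (fun a b => par b = some a) x y := by
      intro k
      induction k with
      | zero =>
        intro x y hk hy
        have := Set.eq_of_subset_of_ncard_le (htrans _ _ hy) (by omega) (Set.toFinite _)
        have hxy : x = y := hanti _ _ (this ▸ hself x) hy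
        rw [hxy]
      | succ k ih =>
        intro x y hk hy
        by_cases hxy : y = x
        · rw [hxy]
        rcases hp : par y with _ | p
        · have hyr := (hroot y).1 hp
          exact absurd (hanti _ _ hy (by rw [hyr, hr]; trivial)) hxy
        · obtain ⟨h1, h2, h3⟩ := hpar y p hp
          have hpx := h3 x hy (Ne.symm hxy)
          have hlt : (D y).ncard < (D p).ncard := by
            apply Set.ncard_lt_ncard _ (Set.toFinite _)
            refine ⟨htrans _ _ h1, fun h4 => h2 (hanti _ _ h1 (h4 (hself p)))⟩
          exact (ih x p (by omega) hpx).tail hp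
    intro k x y _ hy
    exact this _ x y le_rfl hy
  have hsub : ∀ x y, Relation.ReflTransGen (fun a b => par b = some a) x y → y ∈ D x := by
    intro x y h
    induction h with
    | refl => exact hself x
    | tail _ hab ih => exact htrans _ _ ih (hpar _ _ hab).1
  let R : RootedTreeOn V := ⟨r, par, hroot, fun x => hreach _ r x le_rfl (by rw [hr]; trivial)⟩
  have hR : ∀ x, R.subtree x = D x := fun x =>
    Set.ext fun y => ⟨hsub x y, hreach _ x y le_rfl⟩
  have hcomp : ∀ x c, par c = some x → D c ∈ G.componentsOn (D x \ {x}) := by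
    intro x c hc
    obtain ⟨h1, h2, h3⟩ := hpar c x hc
    refine mem_componentsOn_iff.2 ⟨⟨c, hself c⟩, ?_, hconn c, ?_⟩
    · intro y hy
      refine ⟨htrans _ _ h1 hy, ?_⟩
      rintro rfl
      exact h2 (hanti _ _ h1 hy)
    · rintro u hu v ⟨hv, hvx⟩ huv
      rcases hadj u v huv with h4 | h4
      · rcases htotal _ _ _ hu h4 with h5 | h5
        · by_cases hvc : v = c
          · rw [hvc]; exact hself c
          · exact absurd (hanti _ _ hv (h3 v h5 hvc)) hvx
        · exact h5
      · exact htrans _ _ hu h4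
  refine ⟨⟨R, fun x => ?_⟩, hR⟩
  ext C
  constructor
  · rintro ⟨c, hc, rfl⟩
    rw [hR, hR]
    exact hcomp x c hc
  · intro hC
    rw [hR] at hC
    obtain ⟨⟨u, hu⟩, hCU, -, -⟩ := mem_componentsOn_iff.1 hC
    have hux := hCU hu
    obtain ⟨c, hc, huc⟩ := RootedTreeOn.exists_child (T := R) (x := u) (y := x)
      (by rw [hR]; exact hux.1) hux.2
    refine ⟨c, hc, ?_⟩
    rw [hR] at huc ⊢
    exact componentsOn_eq_of_mem (hcomp x c hc) hC huc hu

end SearchTree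

end SimpleGraph

/-! ### Vertices and connected intervals of the caterpillar. -/

namespace Caterpillar

variable {n : ℕ} {m : Fin n → ℕ}

/-- The vertices of the caterpillar: spine vertices and legs. -/
abbrev Vert {n : ℕ} (m : Fin n → ℕ) := Fin n ⊕ (i : Fin n) × Fin (m i)

/-- The index of the spine vertex that a vertex belongs to. -/
def pos : Vert m → ℕ
  | Sum.inl i => i
  | Sum.inr a => a.1

@[simp] theorem pos_inl (i : Fin n) : pos (m := m) (Sum.inl i) = i := rfl
@[simp] theorem pos_inr (a : (i : Fin n) × Fin (m i)) : pos (m := m) (Sum.inr a) = a.1 := rfl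

theorem pos_lt (x : Vert m) : pos x < n := by
  rcases x with i | a
  · exact i.2
  · exact a.1.2

@[simp] theorem adj_inl_inl (i j : Fin n) :
    (caterpillar m).Adj (Sum.inl i) (Sum.inl j) ↔ (i : ℕ) + 1 = j ∨ (j : ℕ) + 1 = i := by
  simp only [caterpillar, SimpleGraph.fromRel_adj, ne_eq, Sum.inl.injEq, and_iff_right_iff_imp]
  rintro h rfl
  omega

@[simp] theorem adj_inl_inr (i : Fin n) (a : (i : Fin n) × Fin (m i)) :
    (caterpillar m).Adj (Sum.inl i) (Sum.inr a) ↔ i = a.1 := by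
  simp [caterpillar, SimpleGraph.fromRel_adj]

@[simp] theorem adj_inr_inl (i : Fin n) (a : (i : Fin n) × Fin (m i)) :
    (caterpillar m).Adj (Sum.inr a) (Sum.inl i) ↔ i = a.1 := by
  simp [caterpillar, SimpleGraph.fromRel_adj]

@[simp] theorem adj_inr_inr (a b : (i : Fin n) × Fin (m i)) :
    ¬ (caterpillar m).Adj (Sum.inr a) (Sum.inr b) := by
  simp [caterpillar, SimpleGraph.fromRel_adj]

/-- The spine vertices with index in `[lo, hi)`, with those of their legs that are in `A`. -/
def verts (lo hi : ℕ) (A : Set ((i : Fin n) × Fin (m i))) : Set (Vert m) :=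
  {x | lo ≤ pos x ∧ pos x < hi ∧ ∀ a, x = Sum.inr a → a ∈ A}

@[simp] theorem inl_mem_verts {lo hi : ℕ} {A : Set ((i : Fin n) × Fin (m i))} {i : Fin n} :
    Sum.inl i ∈ verts lo hi A ↔ lo ≤ (i : ℕ) ∧ (i : ℕ) < hi := by
  simp [verts]

@[simp] theorem inr_mem_verts {lo hi : ℕ} {A : Set ((i : Fin n) × Fin (m i))}
    {a : (i : Fin n) × Fin (m i)} :
    Sum.inr a ∈ verts lo hi A ↔ lo ≤ (a.1 : ℕ) ∧ (a.1 : ℕ) < hi ∧ a ∈ A := by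
  simp [verts]

theorem pos_of_mem_verts {lo hi : ℕ} {A : Set ((i : Fin n) × Fin (m i))} {x : Vert m}
    (h : x ∈ verts lo hi A) : lo ≤ pos x ∧ pos x < hi := ⟨h.1, h.2.1⟩

theorem verts_congr {lo hi : ℕ} {A B : Set ((i : Fin n) × Fin (m i))}
    (h : ∀ a, lo ≤ (a.1 : ℕ) → (a.1 : ℕ) < hi → (a ∈ A ↔ a ∈ B)) :
    verts lo hi A = verts lo hi B := by
  ext x
  rcases x with i | a
  · simp
  · simp only [inr_mem_verts]
    constructor
    · rintro ⟨h1, h2, h3⟩; exact ⟨h1, h2, (h a h1 h2).1 h3⟩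
    · rintro ⟨h1, h2, h3⟩; exact ⟨h1, h2, (h a h1 h2).2 h3⟩

theorem verts_univ : verts 0 n (Set.univ : Set ((i : Fin n) × Fin (m i))) = Set.univ := by
  ext x
  simp [verts, pos_lt]

theorem verts_mono {lo hi lo' hi' : ℕ} {A : Set ((i : Fin n) × Fin (m i))} (h1 : lo ≤ lo')
    (h2 : hi' ≤ hi) : verts lo' hi' A ⊆ verts lo hi A :=
  fun _ hx => ⟨h1.trans hx.1, hx.2.1.trans_le h2, hx.2.2⟩

theorem verts_diff {lo hi : ℕ} {A : Set ((i : Fin n) × Fin (m i))} (a : (i : Fin n) × Fin (m i)) :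
    verts lo hi A \ {Sum.inr a} = verts lo hi (A \ {a}) := by
  ext x
  rcases x with i | b
  · simp
  · simp only [Set.mem_sdiff, inr_mem_verts, Set.mem_singleton_iff, Sum.inr.injEq]
    tauto

theorem mem_verts_split {lo hi : ℕ} {A : Set ((i : Fin n) × Fin (m i))} {x : Vert m}
    (hx : x ∈ verts lo hi A) (j : Fin n) : x = Sum.inl j ∨ (∃ a ∈ A, a.1 = j ∧ x = Sum.inr a) ∨
      x ∈ verts lo j A ∨ x ∈ verts (j + 1) hi A := by
  rcases lt_trichotomy (pos x) j with h | h | h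
  · exact Or.inr (Or.inr (Or.inl ⟨hx.1, h, hx.2.2⟩))
  · rcases x with i | a
    · exact Or.inl (congrArg _ (Fin.ext h))
    · exact Or.inr (Or.inl ⟨a, hx.2.2 a rfl, Fin.ext h, rfl⟩)
  · exact Or.inr (Or.inr (Or.inr ⟨h, hx.2.1, hx.2.2⟩))

theorem preconnected_verts (lo hi : ℕ) (hhi : hi ≤ n) (A : Set ((i : Fin n) × Fin (m i))) :
    ((caterpillar m).induce (verts lo hi A)).Preconnected := by
  have spine : ∀ (j : ℕ) (hlo : lo ≤ j) (hj : j < hi),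
      ((caterpillar m).induce (verts lo hi A)).Reachable
        ⟨Sum.inl ⟨lo, by omega⟩, by simp; omega⟩ ⟨Sum.inl ⟨j, by omega⟩, by simp; omega⟩ := by
    intro j hlo
    induction j, hlo using Nat.le_induction with
    | base => intro _; exact SimpleGraph.Reachable.refl _
    | succ j hlo ih =>
      intro hj
      refine (ih (by omega)).trans (SimpleGraph.Adj.reachable ?_)
      simp
  have all : ∀ (x : verts lo hi A), ∃ hlo : lo < hi,
      ((caterpillar m).induce (verts lo hi A)).Reachable
        ⟨Sum.inl ⟨lo, by omega⟩, by simp; omega⟩ x := by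
    rintro ⟨i | a, hx⟩
    · have hx' := inl_mem_verts.1 hx
      exact ⟨by omega, spine i hx'.1 hx'.2⟩
    · have hx' := inr_mem_verts.1 hx
      refine ⟨by omega, (spine a.1 hx'.1 hx'.2.1).trans (SimpleGraph.Adj.reachable ?_)⟩
      simp
  intro x y
  obtain ⟨_, hx⟩ := all x
  obtain ⟨_, hy⟩ := all y
  exact hx.symm.trans hy

theorem preconnected_singleton (x : Vert m) :
    ((caterpillar m).induce {x}).Preconnected := by
  rintro ⟨a, rfl⟩ ⟨b, rfl⟩
  rfl

theorem preconnected : (caterpillar m).Preconnected := by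
  have h := preconnected_verts (m := m) 0 n le_rfl Set.univ
  rw [verts_univ] at h
  exact h.map (f := ⟨fun x => x.1, fun h => h⟩) fun x => ⟨⟨x, trivial⟩, rfl⟩

/-! ### Concrete trees and their descendant sets. -/

/-- Concrete search trees on caterpillars. A node `leg a t` is a leg removed before its spine
vertex; the legs that are not removed before their spine vertex `j` are implicit children of the
node `sp j l r`. -/
inductive CTree {n : ℕ} (m : Fin n → ℕ) where
  | nil : CTree m
  | leg (a : (i : Fin n) × Fin (m i)) (t : CTree m) : CTree m
  | sp (j : Fin n) (l r : CTree m) : CTree m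

namespace CTree

/-- `t` is a search tree on the graph induced by `verts lo hi A`. -/
def Valid : CTree m → ℕ → ℕ → Set ((i : Fin n) × Fin (m i)) → Prop
  | nil, lo, hi, _ => hi ≤ lo
  | leg a t, lo, hi, A => lo ≤ (a.1 : ℕ) ∧ (a.1 : ℕ) < hi ∧ a ∈ A ∧ t.Valid lo hi (A \ {a})
  | sp j l r, lo, hi, A => lo ≤ (j : ℕ) ∧ (j : ℕ) < hi ∧ l.Valid lo j A ∧ r.Valid (j + 1) hi A

/-- The node set of the subtree of the node `x` in a concrete search tree. -/
def desc : CTree m → ℕ → ℕ → Set ((i : Fin n) × Fin (m i)) → Vert m → Set (Vert m)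
  | nil, _, _, _, _ => ∅
  | leg a t, lo, hi, A, x => if x = Sum.inr a then verts lo hi A else t.desc lo hi (A \ {a}) x
  | sp j l r, lo, hi, A, x =>
      if x = Sum.inl j then verts lo hi A
      else if pos x = j then {x}
      else if pos x < j then l.desc lo j A x
      else r.desc (j + 1) hi A x

/-- The edge between `p` and its child `c` is rotated. -/
inductive Step : Vert m → Vert m → CTree m → CTree m → Prop
  | spine (p c l k r) (h : p < c) :
      Step (.inl p) (.inl c) (sp p l (sp c k r)) (sp c (sp p l k) r)
  | legs (a b t) : Step (.inr a) (.inr b) (leg a (leg b t)) (leg b (leg a t))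
  | left (a c l r) (h : a.1 < c) :
      Step (.inr a) (.inl c) (leg a (sp c l r)) (sp c (leg a l) r)
  | right (a c l r) (h : c < a.1) :
      Step (.inr a) (.inl c) (leg a (sp c l r)) (sp c l (leg a r))
  | down (a l r) : Step (.inr a) (.inl a.1) (leg a (sp a.1 l r)) (sp a.1 l r)
  | congr_leg (a) {p c t t'} (h : Step p c t t') : Step p c (leg a t) (leg a t')
  | congr_left (j r) {p c t t'} (h : Step p c t t') : Step p c (sp j t r) (sp j t' r)
  | congr_right (j l) {p c t t'} (h : Step p c t t') : Step p c (sp j l t) (sp j l t')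

variable {t t' l r : CTree m} {lo hi : ℕ} {A B : Set ((i : Fin n) × Fin (m i))} {x y : Vert m}

/-- Only the legs with index in `[lo, hi)` matter in `A`. Hence a spine node can hand the same `A`
to both sides, and a leg outside the interval can be added or dropped freely. -/
theorem Valid.congr (h : t.Valid lo hi A)
    (hAB : ∀ a, lo ≤ (a.1 : ℕ) → (a.1 : ℕ) < hi → (a ∈ A ↔ a ∈ B)) : t.Valid lo hi B := by
  induction t generalizing lo hi A B with
  | nil => exact h
  | leg a t ih =>
    obtain ⟨h1, h2, h3, h4⟩ := h
    refine ⟨h1, h2, (hAB a h1 h2).1 h3, ih h4 ?_⟩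
    intro b hb1 hb2
    simp only [Set.mem_sdiff, hAB b hb1 hb2]
  | sp j l r ihl ihr =>
    obtain ⟨h1, h2, h3, h4⟩ := h
    exact ⟨h1, h2, ihl h3 fun a ha hb => hAB a ha (by omega),
      ihr h4 fun a ha hb => hAB a (by omega) hb⟩

theorem desc_congr (h : t.Valid lo hi A)
    (hAB : ∀ a, lo ≤ (a.1 : ℕ) → (a.1 : ℕ) < hi → (a ∈ A ↔ a ∈ B)) (x : Vert m) :
    t.desc lo hi A x = t.desc lo hi B x := by
  induction t generalizing lo hi A B with
  | nil => rfl
  | leg a t ih =>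
    obtain ⟨h1, h2, h3, h4⟩ := h
    simp only [desc]
    rw [verts_congr hAB, ih h4 (B := B \ {a})]
    intro b hb1 hb2
    simp only [Set.mem_sdiff, hAB b hb1 hb2]
  | sp j l r ihl ihr =>
    obtain ⟨h1, h2, h3, h4⟩ := h
    simp only [desc]
    rw [verts_congr hAB, ihl h3 fun a ha hb => hAB a ha (by omega),
      ihr h4 fun a ha hb => hAB a (by omega) hb]

theorem desc_leg_self (a : (i : Fin n) × Fin (m i)) :
    (leg a t).desc lo hi A (.inr a) = verts lo hi A := by simp [desc]

theorem desc_leg_of_ne {a : (i : Fin n) × Fin (m i)} (h : x ≠ .inr a) :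
    (leg a t).desc lo hi A x = t.desc lo hi (A \ {a}) x := by simp [desc, h]

theorem desc_sp_self (j : Fin n) :
    (sp j l r).desc lo hi A (.inl j) = verts lo hi A := by simp [desc]

theorem desc_sp_leg {j : Fin n} {a : (i : Fin n) × Fin (m i)} (h : a.1 = j) :
    (sp j l r).desc lo hi A (.inr a) = {.inr a} := by simp [desc, h]

theorem desc_sp_left {j : Fin n} (h : x ∈ verts lo j A) :
    (sp j l r).desc lo hi A x = l.desc lo j A x := by
  have h1 := h.2.1
  have h2 : x ≠ Sum.inl j := by rintro rfl; simp at h1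
  simp [desc, h2, h1, h1.ne]

theorem desc_sp_right {j : Fin n} (h : x ∈ verts (j + 1) hi A) :
    (sp j l r).desc lo hi A x = r.desc (j + 1) hi A x := by
  have h1 : (j : ℕ) < pos x := h.1
  have h2 : x ≠ Sum.inl j := by rintro rfl; simp at h1
  simp [desc, h2, h1.ne', not_lt.2 h1.le]

theorem mem_verts_leg {a : (i : Fin n) × Fin (m i)} (hx : x ∈ verts lo hi A) (h : x ≠ .inr a) :
    x ∈ verts lo hi (A \ {a}) := by
  rw [← verts_diff]; exact ⟨hx, h⟩

/-- Gives the connectedness of descendant sets; the singletons come from the implicit legs. -/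
theorem Valid.desc_eq (h : t.Valid lo hi A) (hx : x ∈ verts lo hi A) :
    (∃ lo' hi' A', lo ≤ lo' ∧ hi' ≤ hi ∧ A' ⊆ A ∧ t.desc lo hi A x = verts lo' hi' A') ∨
      t.desc lo hi A x = {x} := by
  induction t generalizing lo hi A with
  | nil =>
    obtain ⟨h1, h2⟩ := pos_of_mem_verts hx
    have : hi ≤ lo := h
    omega
  | leg a t ih =>
    by_cases hxa : x = .inr a
    · subst hxa
      exact Or.inl ⟨lo, hi, A, le_rfl, le_rfl, subset_rfl, desc_leg_self a⟩
    · rw [desc_leg_of_ne hxa]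
      rcases ih h.2.2.2 (mem_verts_leg hx hxa) with ⟨lo', hi', A', h1, h2, h3, h4⟩ | h1
      · exact Or.inl ⟨lo', hi', A', h1, h2, h3.trans Set.sdiff_subset, h4⟩
      · exact Or.inr h1
  | sp j l r ihl ihr =>
    obtain ⟨hj1, hj2, hl, hr⟩ := h
    rcases mem_verts_split hx j with rfl | ⟨a, haA, haj, rfl⟩ | hx | hx
    · exact Or.inl ⟨lo, hi, A, le_rfl, le_rfl, subset_rfl, desc_sp_self j⟩
    · exact Or.inr (desc_sp_leg haj)
    · rw [desc_sp_left hx]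
      rcases ihl hl hx with ⟨lo', hi', A', h1, h2, h3, h4⟩ | h1
      · exact Or.inl ⟨lo', hi', A', h1, by omega, h3, h4⟩
      · exact Or.inr h1
    · rw [desc_sp_right hx]
      rcases ihr hr hx with ⟨lo', hi', A', h1, h2, h3, h4⟩ | h1
      · exact Or.inl ⟨lo', hi', A', by omega, h2, h3, h4⟩
      · exact Or.inr h1

theorem Valid.desc_subset (h : t.Valid lo hi A) (hx : x ∈ verts lo hi A) :
    t.desc lo hi A x ⊆ verts lo hi A := by
  rcases h.desc_eq hx with ⟨lo', hi', A', h1, h2, h3, h4⟩ | h1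
  · rw [h4]
    exact fun y hy => ⟨h1.trans hy.1, hy.2.1.trans_le h2, fun a ha => h3 (hy.2.2 a ha)⟩
  · rw [h1]
    exact Set.singleton_subset_iff.2 hx

theorem Valid.self_mem_desc (h : t.Valid lo hi A) (hx : x ∈ verts lo hi A) :
    x ∈ t.desc lo hi A x := by
  induction t generalizing lo hi A with
  | nil =>
    obtain ⟨h1, h2⟩ := pos_of_mem_verts hx
    have : hi ≤ lo := h
    omega
  | leg a t ih =>
    by_cases hxa : x = .inr a
    · subst hxa
      rwa [desc_leg_self a]
    · rw [desc_leg_of_ne hxa]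
      exact ih h.2.2.2 (mem_verts_leg hx hxa)
  | sp j l r ihl ihr =>
    obtain ⟨hj1, hj2, hl, hr⟩ := h
    rcases mem_verts_split hx j with rfl | ⟨a, haA, haj, rfl⟩ | hx | hx
    · rwa [desc_sp_self]
    · rw [desc_sp_leg haj]; rfl
    · rw [desc_sp_left hx]; exact ihl hl hx
    · rw [desc_sp_right hx]; exact ihr hr hx

theorem Valid.desc_trans (h : t.Valid lo hi A) (hx : x ∈ verts lo hi A)
    (hy : y ∈ t.desc lo hi A x) : t.desc lo hi A y ⊆ t.desc lo hi A x := by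
  induction t generalizing lo hi A with
  | nil => exact absurd hy (Set.notMem_empty _)
  | leg a t ih =>
    have hyv := h.desc_subset hx hy
    by_cases hxa : x = .inr a
    · subst hxa
      rw [desc_leg_self a]
      exact h.desc_subset hyv
    · have hx' := mem_verts_leg hx hxa
      rw [desc_leg_of_ne hxa] at hy ⊢
      have hya : y ≠ .inr a := by
        rintro rfl
        simpa using h.2.2.2.desc_subset hx' hy
      rw [desc_leg_of_ne hya]
      exact ih h.2.2.2 hx' hy
  | sp j l r ihl ihr =>
    have hyv := h.desc_subset hx hy
    have hv := h
    obtain ⟨hj1, hj2, hl, hr⟩ := h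
    rcases mem_verts_split hx j with rfl | ⟨a, haA, haj, rfl⟩ | hx | hx
    · rw [desc_sp_self]; exact hv.desc_subset hyv
    · rw [desc_sp_leg haj] at hy
      obtain rfl : y = _ := hy
      exact subset_rfl
    · rw [desc_sp_left hx] at hy ⊢
      rw [desc_sp_left (hl.desc_subset hx hy)]
      exact ihl hl hx hy
    · rw [desc_sp_right hx] at hy ⊢
      rw [desc_sp_right (hr.desc_subset hx hy)]
      exact ihr hr hx hy

theorem Valid.desc_antisymm (h : t.Valid lo hi A) (hx : x ∈ verts lo hi A)
    (hyv : y ∈ verts lo hi A) (hxy : x ∈ t.desc lo hi A y) (hyx : y ∈ t.desc lo hi A x) :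
    x = y := by
  induction t generalizing lo hi A with
  | nil => exact absurd hxy (Set.notMem_empty _)
  | leg a t ih =>
    have key : ∀ z ∈ verts lo hi A, Sum.inr a ∈ (leg a t).desc lo hi A z → z = .inr a := by
      intro z hz hmem
      by_contra hza
      rw [desc_leg_of_ne hza] at hmem
      simpa using h.2.2.2.desc_subset (mem_verts_leg hz hza) hmem
    by_cases hxa : x = .inr a
    · subst hxa
      exact (key y hyv hxy).symm
    by_cases hya : y = .inr a
    · subst hya
      exact key x hx hyx
    rw [desc_leg_of_ne hxa] at hyx
    rw [desc_leg_of_ne hya] at hxy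
    exact ih h.2.2.2 (mem_verts_leg hx hxa) (mem_verts_leg hyv hya) hxy hyx
  | sp j l r ihl ihr =>
    obtain ⟨hj1, hj2, hl, hr⟩ := h
    have key : ∀ z ∈ verts lo hi A, Sum.inl j ∈ (sp j l r).desc lo hi A z → z = .inl j := by
      intro z hz hmem
      rcases mem_verts_split hz j with rfl | ⟨a, haA, haj, rfl⟩ | hz | hz
      · rfl
      · rw [desc_sp_leg haj] at hmem; exact hmem.symm
      · rw [desc_sp_left hz] at hmem
        simpa using hl.desc_subset hz hmem
      · rw [desc_sp_right hz] at hmem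
        simpa using hr.desc_subset hz hmem
    rcases mem_verts_split hx j with rfl | ⟨a, haA, haj, rfl⟩ | hx | hx
    · exact (key y hyv hxy).symm
    · rw [desc_sp_leg haj] at hyx; exact hyx.symm
    · rw [desc_sp_left hx] at hyx
      have hy := hl.desc_subset hx hyx
      rw [desc_sp_left hy] at hxy
      exact ihl hl hx hy hxy hyx
    · rw [desc_sp_right hx] at hyx
      have hy := hr.desc_subset hx hyx
      rw [desc_sp_right hy] at hxy
      exact ihr hr hx hy hxy hyx

theorem Valid.desc_total {z : Vert m} (h : t.Valid lo hi A) (hx : x ∈ verts lo hi A)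
    (hy : y ∈ verts lo hi A) (hzx : z ∈ t.desc lo hi A x) (hzy : z ∈ t.desc lo hi A y) :
    x ∈ t.desc lo hi A y ∨ y ∈ t.desc lo hi A x := by
  induction t generalizing lo hi A with
  | nil => exact absurd hzx (Set.notMem_empty _)
  | leg a t ih =>
    by_cases hxa : x = .inr a
    · subst hxa
      rw [desc_leg_self a]
      exact Or.inr hy
    by_cases hya : y = .inr a
    · subst hya
      rw [desc_leg_self a]
      exact Or.inl hx
    rw [desc_leg_of_ne hxa] at hzx ⊢
    rw [desc_leg_of_ne hya] at hzy ⊢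
    exact ih h.2.2.2 (mem_verts_leg hx hxa) (mem_verts_leg hy hya) hzx hzy
  | sp j l r ihl ihr =>
    have hv := h
    obtain ⟨hj1, hj2, hl, hr⟩ := h
    rcases mem_verts_split hx j with rfl | ⟨a, haA, haj, rfl⟩ | hx' | hx'
    · rw [desc_sp_self]; exact Or.inr hy
    · rw [desc_sp_leg haj] at hzx
      obtain rfl : z = _ := hzx
      exact Or.inl hzy
    · rw [desc_sp_left hx'] at hzx
      have hz := hl.desc_subset hx' hzx
      rcases mem_verts_split hy j with rfl | ⟨a, haA, haj, rfl⟩ | hy' | hy'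
      · rw [desc_sp_self]; exact Or.inl hx
      · rw [desc_sp_leg haj] at hzy
        obtain rfl : z = _ := hzy
        rw [← desc_sp_left (hi := hi) (r := r) hx'] at hzx
        exact Or.inr hzx
      · rw [desc_sp_left hy'] at hzy ⊢
        rw [desc_sp_left hx']
        exact ihl hl hx' hy' hzx hzy
      · rw [desc_sp_right hy'] at hzy
        have := (hr.desc_subset hy' hzy).1
        have := hz.2.1
        omega
    · rw [desc_sp_right hx'] at hzx
      have hz := hr.desc_subset hx' hzx
      rcases mem_verts_split hy j with rfl | ⟨a, haA, haj, rfl⟩ | hy' | hy'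
      · rw [desc_sp_self]; exact Or.inl hx
      · rw [desc_sp_leg haj] at hzy
        obtain rfl : z = _ := hzy
        rw [← desc_sp_right (lo := lo) (l := l) hx'] at hzx
        exact Or.inr hzx
      · rw [desc_sp_left hy'] at hzy
        have := (hl.desc_subset hy' hzy).2.1
        have := hz.1
        omega
      · rw [desc_sp_right hy'] at hzy ⊢
        rw [desc_sp_right hx']
        exact ihr hr hx' hy' hzx hzy

theorem Valid.mem_desc_or_of_adj (h : t.Valid lo hi A) (hx : x ∈ verts lo hi A)
    (hy : y ∈ verts lo hi A) (hxy : (caterpillar m).Adj x y) :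
    x ∈ t.desc lo hi A y ∨ y ∈ t.desc lo hi A x := by
  induction t generalizing lo hi A with
  | nil =>
    obtain ⟨h1, h2⟩ := pos_of_mem_verts hx
    have : hi ≤ lo := h
    omega
  | leg a t ih =>
    by_cases hxa : x = .inr a
    · subst hxa
      rw [desc_leg_self a]
      exact Or.inr hy
    by_cases hya : y = .inr a
    · subst hya
      rw [desc_leg_self a]
      exact Or.inl hx
    rw [desc_leg_of_ne hxa, desc_leg_of_ne hya]
    exact ih h.2.2.2 (mem_verts_leg hx hxa) (mem_verts_leg hy hya)
  | sp j l r ihl ihr =>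
    obtain ⟨hj1, hj2, hl, hr⟩ := h
    have cross : ∀ u v : Vert m, u ∈ verts lo j A → v ∈ verts (j + 1) hi A →
        ¬ (caterpillar m).Adj u v := by
      rintro (u | u) (v | v) hu hv huv <;> simp at hu hv huv
      · omega
      · subst huv; omega
      · subst huv; omega
    have cross' : ∀ (a : (i : Fin n) × Fin (m i)) (v : Vert m), a.1 = j →
        (caterpillar m).Adj (.inr a) v → v = .inl j := by
      rintro a (v | v) ha hav <;> simp at hav
      rw [hav, ha]
    rcases mem_verts_split hx j with rfl | ⟨a, haA, haj, rfl⟩ | hx' | hx'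
    · rw [desc_sp_self]; exact Or.inr hy
    · rw [cross' a y haj hxy, desc_sp_self]; exact Or.inl hx
    · rcases mem_verts_split hy j with rfl | ⟨a, haA, haj, rfl⟩ | hy' | hy'
      · rw [desc_sp_self]; exact Or.inl hx
      · rw [cross' a x haj hxy.symm, desc_sp_self]; exact Or.inr hy
      · rw [desc_sp_left hx', desc_sp_left hy']; exact ihl hl hx' hy'
      · exact absurd hxy (cross x y hx' hy')
    · rcases mem_verts_split hy j with rfl | ⟨a, haA, haj, rfl⟩ | hy' | hy'
      · rw [desc_sp_self]; exact Or.inl hx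
      · rw [cross' a x haj hxy.symm, desc_sp_self]; exact Or.inr hy
      · exact absurd hxy.symm (cross y x hy' hx')
      · rw [desc_sp_right hx', desc_sp_right hy']; exact ihr hr hx' hy'

theorem Valid.exists_root (h : t.Valid lo hi A) (hlt : lo < hi) :
    ∃ x ∈ verts lo hi A, t.desc lo hi A x = verts lo hi A := by
  cases t with
  | nil => exact absurd h (not_le.2 hlt)
  | leg a t => exact ⟨.inr a, by simp [h.1, h.2.1, h.2.2.1], desc_leg_self a⟩
  | sp j l r => exact ⟨.inl j, by simp [h.1, h.2.1], desc_sp_self j⟩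

/-! ### Search trees versus concrete trees. -/

/-- The search tree `T` is described by the concrete tree `t`. -/
def Rep (T : (caterpillar m).SearchTree) (t : CTree m) : Prop :=
  t.Valid 0 n Set.univ ∧ ∀ x, T.subtree x = t.desc 0 n Set.univ x

theorem Rep.unique {T T' : (caterpillar m).SearchTree} (h : Rep T t) (h' : Rep T' t) : T = T' :=
  SimpleGraph.SearchTree.ext_subtree fun x => (h.2 x).trans (h'.2 x).symm

theorem Valid.exists_rep (hn : 0 < n) (h : t.Valid 0 n Set.univ) :
    ∃ T : (caterpillar m).SearchTree, Rep T t := by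
  have hv : ∀ x : Vert m, x ∈ verts 0 n Set.univ := fun x => verts_univ ▸ Set.mem_univ x
  obtain ⟨r, -, hr⟩ := h.exists_root hn
  obtain ⟨T, hT⟩ := SimpleGraph.SearchTree.exists_subtree_eq (G := caterpillar m)
    (t.desc 0 n Set.univ) (fun x => h.self_mem_desc (hv x)) (fun x y => h.desc_trans (hv x))
    (fun x y => h.desc_antisymm (hv x) (hv y)) (fun x y z => h.desc_total (hv x) (hv y)) r
    (hr.trans verts_univ)
    (fun x => by
      rcases h.desc_eq (hv x) with ⟨lo, hi, A, -, h2, -, h4⟩ | h4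
      · rw [h4]; exact preconnected_verts _ _ h2 _
      · rw [h4]; exact preconnected_singleton x)
    (fun x y => h.mem_desc_or_of_adj (hv x) (hv y))
  exact ⟨T, h, hT⟩

/-- Induction on the number of vertices, by the root of the current subtree. Removing a spine vertex
leaves a left interval, a right interval and isolated legs; removing a leg leaves the interval
connected. An empty interval has no root, hence the premise `lo < hi`. -/
theorem exists_rep_aux (T : (caterpillar m).SearchTree) (k : ℕ) : ∀ lo hi
    (A : Set ((i : Fin n) × Fin (m i))), (verts lo hi A).ncard ≤ k → hi ≤ n →
    (lo < hi → ∃ y, T.subtree y = verts lo hi A) →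
    ∃ t : CTree m, t.Valid lo hi A ∧ ∀ x ∈ verts lo hi A, T.subtree x = t.desc lo hi A x := by
  induction k with
  | zero =>
    intro lo hi A hk hin _
    refine ⟨nil, ?_, ?_⟩
    · by_contra hcon
      have hcon : lo < hi := not_le.1 hcon
      have := (Set.ncard_eq_zero (Set.toFinite _)).1 (Nat.le_zero.1 hk)
      have h2 : (Sum.inl ⟨lo, by omega⟩ : Vert m) ∈ verts lo hi A := by simp [hcon]
      rw [this] at h2
      exact h2
    · intro x hx
      rw [(Set.ncard_eq_zero (Set.toFinite _)).1 (Nat.le_zero.1 hk)] at hx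
      exact absurd hx (Set.notMem_empty _)
  | succ k ih =>
    intro lo hi A hk hin hT
    by_cases hlt : lo < hi
    swap
    · refine ⟨nil, not_lt.1 hlt, fun x hx => ?_⟩
      obtain ⟨h1, h2⟩ := pos_of_mem_verts hx
      omega
    obtain ⟨y, hy⟩ := hT hlt
    have hyv : y ∈ verts lo hi A := hy ▸ T.self_mem_subtree y
    have hcard : ∀ B : Set (Vert m), B ⊆ verts lo hi A → y ∉ B → B.ncard ≤ k := by
      intro B hB hyB
      have := Set.ncard_lt_ncard (s := B) (t := verts lo hi A)
        ⟨hB, fun h => hyB (h hyv)⟩ (Set.toFinite _)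
      omega
    have hcomp : ∀ B : Set (Vert m), B.Nonempty → B ⊆ verts lo hi A \ {y} →
        ((caterpillar m).induce B).Preconnected →
        (∀ u ∈ B, ∀ v ∈ verts lo hi A \ {y}, (caterpillar m).Adj u v → v ∈ B) →
        ∃ c, T.parent c = some y ∧ T.subtree c = B := by
      intro B h1 h2 h3 h4
      refine SimpleGraph.SearchTree.exists_child_subtree_eq
        (SimpleGraph.mem_componentsOn_iff.2 ⟨h1, ?_, h3, ?_⟩)
      · rw [hy]; exact h2
      · rw [hy]; exact h4
    rcases y with j | a
    · obtain ⟨hj1, hj2⟩ := inl_mem_verts.1 hyv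
      have hl : verts lo j A ⊆ verts lo hi A := verts_mono le_rfl hj2.le
      have hr : verts (j + 1) hi A ⊆ verts lo hi A := verts_mono (by omega) le_rfl
      have hjl : Sum.inl j ∉ verts lo j A := by simp
      have hjr : Sum.inl j ∉ verts (j + 1) hi A := by simp
      obtain ⟨l, hlv, hl'⟩ := ih lo j A (hcard _ hl hjl) (by omega) fun h => by
        obtain ⟨c, -, hc⟩ := hcomp (verts lo j A) ⟨.inl ⟨lo, by omega⟩, by simp [h]⟩
          (fun x hx => ⟨hl hx, fun h => hjl (h ▸ hx)⟩) (preconnected_verts _ _ (by omega) _) (by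
            rintro (u | u) hu (v | v) ⟨hv, hvj⟩ huv <;> simp at hu hv huv hvj ⊢
            · rw [Fin.ext_iff] at hvj; omega
            · subst huv; exact ⟨hu.1, hu.2, hv.2.2⟩
            · subst huv; exact ⟨hu.1, hu.2.1⟩)
        exact ⟨c, hc⟩
      obtain ⟨r, hrv, hr'⟩ := ih (j + 1) hi A (hcard _ hr hjr) hin fun h => by
        obtain ⟨c, -, hc⟩ := hcomp (verts (j + 1) hi A) ⟨.inl ⟨j + 1, by omega⟩, by simp [h]⟩
          (fun x hx => ⟨hr hx, fun h => hjr (h ▸ hx)⟩) (preconnected_verts _ _ hin _) (by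
            rintro (u | u) hu (v | v) ⟨hv, hvj⟩ huv <;> simp at hu hv huv hvj ⊢
            · rw [Fin.ext_iff] at hvj; omega
            · subst huv; exact ⟨hu.1, hu.2, hv.2.2⟩
            · subst huv; exact ⟨hu.1, hu.2.1⟩)
        exact ⟨c, hc⟩
      refine ⟨sp j l r, ⟨hj1, hj2, hlv, hrv⟩, fun x hx => ?_⟩
      rcases mem_verts_split hx j with rfl | ⟨a, haA, haj, rfl⟩ | hx | hx
      · rw [desc_sp_self, hy]
      · rw [desc_sp_leg haj]
        obtain ⟨c, -, hc⟩ := hcomp {.inr a} ⟨_, rfl⟩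
          (by rintro _ rfl; exact ⟨hx, by simp⟩) (preconnected_singleton _) (by
            rintro _ rfl (v | v) ⟨hv, hvj⟩ huv <;> simp at huv hvj
            exact absurd (huv.trans haj) hvj)
        have hca : c = .inr a := by
          have := T.self_mem_subtree c
          rw [hc] at this
          exact this
        rw [← hc, hca]
      · rw [desc_sp_left hx]; exact hl' x hx
      · rw [desc_sp_right hx]; exact hr' x hx
    · obtain ⟨ha1, ha2, haA⟩ := inr_mem_verts.1 hyv
      have hsub : verts lo hi (A \ {a}) ⊆ verts lo hi A := by
        rw [← verts_diff]; exact Set.sdiff_subset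
      obtain ⟨t, htv, ht⟩ := ih lo hi (A \ {a}) (hcard _ hsub (by simp)) hin fun _ => by
        obtain ⟨c, -, hc⟩ := hcomp (verts lo hi (A \ {a})) ⟨.inl ⟨lo, by omega⟩, by simp [hlt]⟩
          (by rw [verts_diff]) (preconnected_verts _ _ hin _) (by
            intro u _ v hv _
            rwa [verts_diff] at hv)
        exact ⟨c, hc⟩
      refine ⟨leg a t, ⟨ha1, ha2, haA, htv⟩, fun x hx => ?_⟩
      by_cases hxa : x = .inr a
      · subst hxa
        rw [desc_leg_self, hy]
      · rw [desc_leg_of_ne hxa]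
        exact ht x (mem_verts_leg hx hxa)

theorem exists_rep (T : (caterpillar m).SearchTree) : ∃ t, Rep T t := by
  obtain ⟨t, h1, h2⟩ := exists_rep_aux T _ 0 n Set.univ le_rfl le_rfl fun _ =>
    ⟨T.root, by rw [verts_univ]; exact RootedTreeOn.subtree_root⟩
  exact ⟨t, h1, fun x => h2 x (verts_univ ▸ Set.mem_univ x)⟩

end CTree

/-! ### Rotations versus steps of concrete trees. -/

namespace CTree

variable {t t' l r : CTree m} {lo hi : ℕ} {A B : Set ((i : Fin n) × Fin (m i))} {x y p c : Vert m}

theorem Valid.insert_leg {a : (i : Fin n) × Fin (m i)} (h : t.Valid lo hi (A \ {a}))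
    (ha : (a.1 : ℕ) < lo ∨ hi ≤ (a.1 : ℕ)) : t.Valid lo hi A := by
  refine h.congr fun b hb1 hb2 => ?_
  have : b ≠ a := by rintro rfl; omega
  simp [this]

theorem Valid.erase_leg {a : (i : Fin n) × Fin (m i)} (h : t.Valid lo hi A)
    (ha : (a.1 : ℕ) < lo ∨ hi ≤ (a.1 : ℕ)) : t.Valid lo hi (A \ {a}) := by
  refine h.congr fun b hb1 hb2 => ?_
  have : b ≠ a := by rintro rfl; omega
  simp [this]

theorem Valid.desc_insert_leg {a : (i : Fin n) × Fin (m i)} (h : t.Valid lo hi (A \ {a}))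
    (ha : (a.1 : ℕ) < lo ∨ hi ≤ (a.1 : ℕ)) (x : Vert m) :
    t.desc lo hi (A \ {a}) x = t.desc lo hi A x := by
  refine desc_congr h (fun b hb1 hb2 => ?_) x
  have : b ≠ a := by rintro rfl; omega
  simp [this]

theorem Step.valid (h : Step p c t t') (ht : t.Valid lo hi A) : t'.Valid lo hi A := by
  induction h generalizing lo hi A with
  | spine p c l k r h =>
    obtain ⟨h1, h2, h3, h4, h5, h6, h7⟩ := ht
    exact ⟨by omega, by omega, ⟨by omega, by omega, h3, h6⟩, h7⟩
  | legs a b t =>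
    obtain ⟨h1, h2, h3, h4, h5, h6, h7⟩ := ht
    refine ⟨h4, h5, h6.1, h1, h2, ⟨h3, fun h => h6.2 h.symm⟩, ?_⟩
    rwa [Set.sdiff_sdiff_comm]
  | left a c l r h =>
    obtain ⟨h1, h2, h3, h4, h5, h6, h7⟩ := ht
    exact ⟨h4, h5, ⟨h1, h, h3, h6⟩, h7.insert_leg (by omega)⟩
  | right a c l r h =>
    obtain ⟨h1, h2, h3, h4, h5, h6, h7⟩ := ht
    exact ⟨h4, h5, h6.insert_leg (by omega), ⟨h, h2, h3, h7⟩⟩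
  | down a l r =>
    obtain ⟨h1, h2, h3, h4, h5, h6, h7⟩ := ht
    exact ⟨h4, h5, h6.insert_leg (by omega), h7.insert_leg (by omega)⟩
  | congr_leg a h ih => exact ⟨ht.1, ht.2.1, ht.2.2.1, ih ht.2.2.2⟩
  | congr_left j r h ih => exact ⟨ht.1, ht.2.1, ih ht.2.2.1, ht.2.2.2⟩
  | congr_right j l h ih => exact ⟨ht.1, ht.2.1, ht.2.2.1, ih ht.2.2.2⟩

theorem Step.mem_verts (h : Step p c t t') (ht : t.Valid lo hi A) :
    p ∈ verts lo hi A ∧ c ∈ verts lo hi A ∧ p ≠ c := by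
  induction h generalizing lo hi A with
  | spine p c l k r h =>
    obtain ⟨h1, h2, h3, h4, h5, h6, h7⟩ := ht
    simp only [inl_mem_verts, ne_eq, Sum.inl.injEq]
    exact ⟨⟨h1, h2⟩, ⟨by omega, h5⟩, h.ne⟩
  | legs a b t =>
    obtain ⟨h1, h2, h3, h4, h5, h6, h7⟩ := ht
    simp only [inr_mem_verts, ne_eq, Sum.inr.injEq]
    exact ⟨⟨h1, h2, h3⟩, ⟨h4, h5, h6.1⟩, fun h => h6.2 h.symm⟩
  | left a c l r h =>
    obtain ⟨h1, h2, h3, h4, h5, h6, h7⟩ := ht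
    simp_all
  | right a c l r h =>
    obtain ⟨h1, h2, h3, h4, h5, h6, h7⟩ := ht
    simp_all
  | down a l r =>
    obtain ⟨h1, h2, h3, h4, h5, h6, h7⟩ := ht
    simp_all
  | congr_leg a h ih =>
    obtain ⟨h1, h2, h3⟩ := ih ht.2.2.2
    rw [← verts_diff] at h1 h2
    exact ⟨h1.1, h2.1, h3⟩
  | congr_left j r h ih =>
    obtain ⟨h1, h2, h3⟩ := ih ht.2.2.1
    have := verts_mono (A := A) (le_refl lo) ht.2.1.le
    exact ⟨this h1, this h2, h3⟩
  | congr_right j l h ih =>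
    obtain ⟨h1, h2, h3⟩ := ih ht.2.2.2
    have := verts_mono (A := A) (show lo ≤ (j : ℕ) + 1 from ht.1.trans (Nat.le_succ _)) (le_refl hi)
    exact ⟨this h1, this h2, h3⟩

theorem Step.desc_swap (h : Step p c t t') (ht : t.Valid lo hi A) :
    t.desc lo hi A p = t'.desc lo hi A c ∧
      ∀ x, x ≠ p → x ≠ c → t.desc lo hi A x = t'.desc lo hi A x := by
  induction h generalizing lo hi A with
  | spine p c l k r h =>
    refine ⟨by rw [desc_sp_self, desc_sp_self], fun x hp hc => ?_⟩
    simp only [desc, hp, hc, if_false]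
    split_ifs <;> first | rfl | omega
  | legs a b t =>
    refine ⟨by rw [desc_leg_self, desc_leg_self], fun x hp hc => ?_⟩
    simp only [desc, hp, hc, if_false]
    rw [Set.sdiff_sdiff_comm]
  | left a c l r h =>
    obtain ⟨h1, h2, h3, h4, h5, h6, h7⟩ := ht
    refine ⟨by rw [desc_leg_self, desc_sp_self], fun x hp hc => ?_⟩
    simp only [desc, hp, hc, if_false]
    rw [h7.desc_insert_leg (by omega)]
  | right a c l r h =>
    obtain ⟨h1, h2, h3, h4, h5, h6, h7⟩ := ht
    refine ⟨by rw [desc_leg_self, desc_sp_self], fun x hp hc => ?_⟩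
    simp only [desc, hp, hc, if_false]
    rw [h6.desc_insert_leg (by omega)]
  | down a l r =>
    obtain ⟨h1, h2, h3, h4, h5, h6, h7⟩ := ht
    refine ⟨by rw [desc_leg_self, desc_sp_self], fun x hp hc => ?_⟩
    simp only [desc, hp, hc, if_false]
    rw [h6.desc_insert_leg (by omega), h7.desc_insert_leg (by omega)]
  | congr_leg a h ih =>
    obtain ⟨hp, hc, -⟩ := h.mem_verts ht.2.2.2
    have hpa : _ ≠ Sum.inr a := fun e => (verts_diff (A := A) a ▸ hp).2 e
    have hca : _ ≠ Sum.inr a := fun e => (verts_diff (A := A) a ▸ hc).2 e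
    obtain ⟨i1, i2⟩ := ih ht.2.2.2
    refine ⟨by rw [desc_leg_of_ne hpa, desc_leg_of_ne hca, i1], fun x hxp hxc => ?_⟩
    simp only [desc, i2 x hxp hxc]
  | congr_left j r h ih =>
    obtain ⟨hp, hc, -⟩ := h.mem_verts ht.2.2.1
    obtain ⟨i1, i2⟩ := ih ht.2.2.1
    refine ⟨by rw [desc_sp_left hp, desc_sp_left hc, i1], fun x hxp hxc => ?_⟩
    simp only [desc, i2 x hxp hxc]
  | congr_right j l h ih =>
    obtain ⟨hp, hc, -⟩ := h.mem_verts ht.2.2.2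
    obtain ⟨i1, i2⟩ := ih ht.2.2.2
    refine ⟨by rw [desc_sp_right hp, desc_sp_right hc, i1], fun x hxp hxc => ?_⟩
    simp only [desc, i2 x hxp hxc]

/-- `hc`, `hcp` and `hmin` say that `p` is the parent of `c`. A `Step` covers one direction of each
kind of rotation, so the other direction appears as a reversed step. -/
theorem Valid.exists_step (ht : t.Valid lo hi A) (hp : p ∈ verts lo hi A)
    (hc : c ∈ t.desc lo hi A p) (hcp : c ≠ p)
    (hmin : ∀ y ∈ verts lo hi A, c ∈ t.desc lo hi A y → y ≠ c → p ∈ t.desc lo hi A y) :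
    ∃ t', t'.Valid lo hi A ∧ (Step p c t t' ∨ Step c p t' t) := by
  induction t generalizing lo hi A with
  | nil => exact absurd hc (Set.notMem_empty _)
  | leg a t ih =>
    have hcv := ht.desc_subset hp hc
    obtain ⟨ha1, ha2, haA, htv⟩ := ht
    by_cases hpa : p = .inr a
    · subst hpa
      have hc' := mem_verts_leg hcv hcp
      -- The root of `t` is an ancestor of `c`; were it not `c`, minimality would put the already
      -- removed `a` below it.
      have root : ∀ y ∈ verts lo hi (A \ {a}), t.desc lo hi (A \ {a}) y = verts lo hi (A \ {a}) →
          y = c := by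
        intro y hy hdy
        by_contra hyc
        have hya : y ≠ .inr a := by rintro rfl; simp at hy
        have hyv : y ∈ verts lo hi A := by rw [← verts_diff] at hy; exact hy.1
        have := hmin y hyv (by rw [desc_leg_of_ne hya, hdy]; exact hc') hyc
        rw [desc_leg_of_ne hya, hdy] at this
        simp at this
      cases t with
      | nil =>
        have : hi ≤ lo := htv
        omega
      | leg b t =>
        obtain ⟨hb1, hb2, hbA, htv⟩ := htv
        obtain rfl := root (.inr b) (inr_mem_verts.2 ⟨hb1, hb2, hbA⟩) (desc_leg_self b)
        exact ⟨_, (Step.legs a b t).valid ⟨ha1, ha2, haA, hb1, hb2, hbA, htv⟩,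
          Or.inl (Step.legs a b t)⟩
      | sp j l r =>
        obtain rfl := root (.inl j) (inl_mem_verts.2 ⟨htv.1, htv.2.1⟩) (desc_sp_self j)
        rcases lt_trichotomy a.1 j with h | rfl | h
        · exact ⟨_, (Step.left a j l r h).valid ⟨ha1, ha2, haA, htv⟩, Or.inl (Step.left a j l r h)⟩
        · exact ⟨_, (Step.down a l r).valid ⟨ha1, ha2, haA, htv⟩, Or.inl (Step.down a l r)⟩
        · exact ⟨_, (Step.right a j l r h).valid ⟨ha1, ha2, haA, htv⟩,
            Or.inl (Step.right a j l r h)⟩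
    · have hp' := mem_verts_leg hp hpa
      rw [desc_leg_of_ne hpa] at hc
      obtain ⟨t', hv, hs⟩ := ih htv hp' hc fun y hy hcy hyc => by
        have hya : y ≠ .inr a := by rintro rfl; simp at hy
        have hyv : y ∈ verts lo hi A := by rw [← verts_diff] at hy; exact hy.1
        have := hmin y hyv (by rw [desc_leg_of_ne hya]; exact hcy) hyc
        rwa [desc_leg_of_ne hya] at this
      exact ⟨leg a t', ⟨ha1, ha2, haA, hv⟩, hs.imp (Step.congr_leg a) (Step.congr_leg a)⟩
  | sp j l r ihl ihr =>
    have hcv := ht.desc_subset hp hc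
    have hv := ht
    obtain ⟨hj1, hj2, hl, hr⟩ := ht
    have hlsub : verts lo j A ⊆ verts lo hi A := verts_mono le_rfl hj2.le
    have hrsub : verts (j + 1) hi A ⊆ verts lo hi A := verts_mono (by omega) le_rfl
    rcases mem_verts_split hp j with rfl | ⟨a, haA, haj, rfl⟩ | hp' | hp'
    · rcases mem_verts_split hcv j with rfl | ⟨a, haA, rfl, rfl⟩ | hc' | hc'
      · exact absurd rfl hcp
      -- Rotating an implicit leg with its spine vertex makes the leg explicit, just above that
      -- vertex.
      · exact ⟨leg a (sp a.1 l r), ⟨hj1, hj2, haA, hj1, hj2, hl.erase_leg (by omega),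
          hr.erase_leg (by omega)⟩, Or.inr (Step.down a l r)⟩
      · have root : ∀ y ∈ verts lo j A, l.desc lo j A y = verts lo j A → y = c := by
          intro y hy hdy
          by_contra hyc
          have := hmin y (hlsub hy) (by rw [desc_sp_left hy, hdy]; exact hc') hyc
          rw [desc_sp_left hy, hdy] at this
          simp at this
        cases l with
        | nil =>
          have h1 : (j : ℕ) ≤ lo := hl
          obtain ⟨h2, h3⟩ := pos_of_mem_verts hc'
          omega
        | leg a l =>
          obtain ⟨ha1, ha2, haA, hl⟩ := hl
          obtain rfl := root (.inr a) (inr_mem_verts.2 ⟨ha1, ha2, haA⟩) (desc_leg_self a)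
          exact ⟨leg a (sp j l r), ⟨ha1, by omega, haA, hj1, hj2, hl, hr.erase_leg (by omega)⟩,
            Or.inr (Step.left a j l r ha2)⟩
        | sp k l s =>
          obtain ⟨hk1, hk2, hl, hs⟩ := hl
          obtain rfl := root (.inl k) (inl_mem_verts.2 ⟨hk1, hk2⟩) (desc_sp_self k)
          exact ⟨sp k l (sp j s r), ⟨hk1, by omega, hl, by omega, hj2, hs, hr⟩,
            Or.inr (Step.spine k j l s r hk2)⟩
      · have root : ∀ y ∈ verts (j + 1) hi A, r.desc (j + 1) hi A y = verts (j + 1) hi A →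
            y = c := by
          intro y hy hdy
          by_contra hyc
          have := hmin y (hrsub hy) (by rw [desc_sp_right hy, hdy]; exact hc') hyc
          rw [desc_sp_right hy, hdy] at this
          simp at this
        cases r with
        | nil =>
          have h1 : hi ≤ j + 1 := hr
          obtain ⟨h2, h3⟩ := pos_of_mem_verts hc'
          omega
        | leg a r =>
          obtain ⟨ha1, ha2, haA, hr⟩ := hr
          obtain rfl := root (.inr a) (inr_mem_verts.2 ⟨ha1, ha2, haA⟩) (desc_leg_self a)
          exact ⟨leg a (sp j l r), ⟨by omega, by omega, haA, hj1, hj2, hl.erase_leg (by omega), hr⟩,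
            Or.inr (Step.right a j l r ha1)⟩
        | sp k s r =>
          obtain ⟨hk1, hk2, hs, hr⟩ := hr
          obtain rfl := root (.inl k) (inl_mem_verts.2 ⟨hk1, hk2⟩) (desc_sp_self k)
          exact ⟨_, (Step.spine j k l s r hk1).valid hv, Or.inl (Step.spine j k l s r hk1)⟩
    · rw [desc_sp_leg haj] at hc
      exact absurd hc hcp
    · rw [desc_sp_left hp'] at hc
      obtain ⟨t', hv', hs⟩ := ihl hl hp' hc fun y hy hcy hyc => by
        have := hmin y (hlsub hy) (by rw [desc_sp_left hy]; exact hcy) hyc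
        rwa [desc_sp_left hy] at this
      exact ⟨sp j t' r, ⟨hj1, hj2, hv', hr⟩, hs.imp (Step.congr_left j r) (Step.congr_left j r)⟩
    · rw [desc_sp_right hp'] at hc
      obtain ⟨t', hv', hs⟩ := ihr hr hp' hc fun y hy hcy hyc => by
        have := hmin y (hrsub hy) (by rw [desc_sp_right hy]; exact hcy) hyc
        rwa [desc_sp_right hy] at this
      exact ⟨sp j l t', ⟨hj1, hj2, hl, hv'⟩, hs.imp (Step.congr_right j l) (Step.congr_right j l)⟩

variable {T T' : (caterpillar m).SearchTree}

theorem Rep.subtreesSwap (h : Rep T t) (h' : Rep T' t') (hs : Step p c t t') :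
    SimpleGraph.SearchTree.SubtreesSwap T p c T' := by
  obtain ⟨h1, h2⟩ := hs.desc_swap h.1
  refine ⟨(hs.mem_verts h.1).2.2, ?_, fun x hxp hxc => ?_⟩
  · rw [h.2, h'.2, h1]
  · rw [h.2, h'.2, h2 x hxp hxc]

theorem Rep.adj_of_step (h : Rep T t) (h' : Rep T' t') (hs : Step p c t t') :
    (caterpillar m).rotationGraph.Adj T T' := by
  have hsw := h.subtreesSwap h' hs
  refine (SimpleGraph.fromRel_adj _ _ _).2 ⟨?_, Or.inl ⟨p, c, hsw.isRotation preconnected⟩⟩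
  rintro rfl
  have h1 := RootedTreeOn.mem_subtree_of_parent hsw.parent_eq
  have h2 := RootedTreeOn.mem_subtree_of_parent hsw.symm.parent_eq
  exact hsw.1 (RootedTreeOn.mem_subtree_antisymm h2 h1)

theorem Rep.exists_step (hn : 0 < n) (h : Rep T t) (hrot : T.IsRotation p c T') :
    ∃ t', Rep T' t' ∧ (Step p c t t' ∨ Step c p t' t) ∧
      SimpleGraph.SearchTree.SubtreesSwap T p c T' := by
  obtain ⟨h1, h2, h3⟩ := RootedTreeOn.parent_eq_some_iff.1 hrot.1
  simp only [h.2] at h1 h3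
  obtain ⟨t', hv, hs⟩ := h.1.exists_step (p := p) (c := c) (verts_univ ▸ Set.mem_univ p) h1 h2
    fun y _ => h3 y
  obtain ⟨T'', hT''⟩ := hv.exists_rep hn
  have hsw : SimpleGraph.SearchTree.SubtreesSwap T p c T'' := by
    rcases hs with hs | hs
    · exact h.subtreesSwap hT'' hs
    · exact (hT''.subtreesSwap h hs).symm
  obtain rfl := hrot.unique (hsw.isRotation preconnected)
  exact ⟨t', hT'', hs, hsw⟩

/-- Adjacency may stem from a rotation of `T'` into `T`; the symmetry of `SubtreesSwap` turns it
into one of `T` into `T'`. -/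
theorem Rep.exists_step_of_adj (hn : 0 < n) (h : Rep T t)
    (hadj : (caterpillar m).rotationGraph.Adj T T') :
    ∃ t', Rep T' t' ∧ ∃ p c, Step p c t t' ∨ Step p c t' t := by
  have key : ∃ p c, T.IsRotation p c T' := by
    obtain ⟨-, ⟨p, c, hrot⟩ | ⟨p, c, hrot⟩⟩ := (SimpleGraph.fromRel_adj _ _ _).1 hadj
    · exact ⟨p, c, hrot⟩
    · obtain ⟨t', h'⟩ := exists_rep T'
      obtain ⟨-, -, -, hsw⟩ := h'.exists_step hn hrot
      exact ⟨c, p, hsw.symm.isRotation preconnected⟩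
  obtain ⟨p, c, hrot⟩ := key
  obtain ⟨t', h', hs, -⟩ := h.exists_step hn hrot
  exact ⟨t', h', hs.elim (fun h => ⟨p, c, Or.inl h⟩) fun h => ⟨c, p, Or.inr h⟩⟩

end CTree

/-! ### Potentials on concrete trees. -/

namespace CTree

variable {t t' l r : CTree m} {lo mid hi : ℕ} {A B : Set ((i : Fin n) × Fin (m i))}
  {x y p c : Vert m}

/-- The roots agree, since each is a descendant of the other; the rest follows recursively. A
potential on `CTree` is therefore well defined on search trees. -/
theorem Valid.eq_of_desc_eq (ht : t.Valid lo hi A) (ht' : t'.Valid lo hi A)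
    (h : ∀ x ∈ verts lo hi A, t.desc lo hi A x = t'.desc lo hi A x) : t = t' := by
  have root : ∀ x ∈ verts lo hi A, ∀ y ∈ verts lo hi A, t.desc lo hi A x = verts lo hi A →
      t'.desc lo hi A y = verts lo hi A → x = y := by
    intro x hx y hy hdx hdy
    refine ht.desc_antisymm hx hy ?_ ?_
    · rw [h y hy, hdy]; exact hx
    · rw [hdx]; exact hy
  induction t generalizing lo hi A t' with
  | nil =>
    have h1 : hi ≤ lo := ht
    cases t' with
    | nil => rfl
    | leg a t' => have := ht'.1; have := ht'.2.1; omega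
    | sp j l r => have := ht'.1; have := ht'.2.1; omega
  | leg a t ih =>
    have ha : Sum.inr a ∈ verts lo hi A := inr_mem_verts.2 ⟨ht.1, ht.2.1, ht.2.2.1⟩
    cases t' with
    | nil => have : hi ≤ lo := ht'; have := ht.1; have := ht.2.1; omega
    | leg b t' =>
      have hb : Sum.inr b ∈ verts lo hi A := inr_mem_verts.2 ⟨ht'.1, ht'.2.1, ht'.2.2.1⟩
      obtain rfl := Sum.inr.inj (root _ ha _ hb (desc_leg_self a) (desc_leg_self b))
      have heq : ∀ x ∈ verts lo hi (A \ {a}),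
          t.desc lo hi (A \ {a}) x = t'.desc lo hi (A \ {a}) x := by
        intro x hx
        rw [← verts_diff] at hx
        have := h x hx.1
        rwa [desc_leg_of_ne hx.2, desc_leg_of_ne hx.2] at this
      congr 1
      refine ih ht.2.2.2 ht'.2.2.2 heq fun x hx y hy hdx hdy => ?_
      refine ht.2.2.2.desc_antisymm hx hy ?_ ?_
      · rw [heq y hy, hdy]; exact hx
      · rw [hdx]; exact hy
    | sp j l r =>
      have hj : Sum.inl j ∈ verts lo hi A := inl_mem_verts.2 ⟨ht'.1, ht'.2.1⟩
      cases root _ ha _ hj (desc_leg_self a) (desc_sp_self j)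
  | sp j l r ihl ihr =>
    have hj : Sum.inl j ∈ verts lo hi A := inl_mem_verts.2 ⟨ht.1, ht.2.1⟩
    cases t' with
    | nil => have : hi ≤ lo := ht'; have := ht.1; have := ht.2.1; omega
    | leg b t' =>
      have hb : Sum.inr b ∈ verts lo hi A := inr_mem_verts.2 ⟨ht'.1, ht'.2.1, ht'.2.2.1⟩
      cases root _ hj _ hb (desc_sp_self j) (desc_leg_self b)
    | sp k l' r' =>
      have hk : Sum.inl k ∈ verts lo hi A := inl_mem_verts.2 ⟨ht'.1, ht'.2.1⟩
      obtain rfl := Sum.inl.inj (root _ hj _ hk (desc_sp_self j) (desc_sp_self k))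
      obtain ⟨hj1, hj2, hl, hr⟩ := ht
      obtain ⟨-, -, hl', hr'⟩ := ht'
      have heql : ∀ x ∈ verts lo j A, l.desc lo j A x = l'.desc lo j A x := by
        intro x hx
        have := h x (verts_mono le_rfl hj2.le hx)
        rwa [desc_sp_left hx, desc_sp_left hx] at this
      have heqr : ∀ x ∈ verts (j + 1) hi A,
          r.desc (j + 1) hi A x = r'.desc (j + 1) hi A x := by
        intro x hx
        have := h x (verts_mono (by omega) le_rfl hx)
        rwa [desc_sp_right hx, desc_sp_right hx] at this
      congr 1
      · refine ihl hl hl' heql fun x hx y hy hdx hdy => hl.desc_antisymm hx hy ?_ ?_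
        · rw [heql y hy, hdy]; exact hx
        · rw [hdx]; exact hy
      · refine ihr hr hr' heqr fun x hx y hy hdx hdy => hr.desc_antisymm hx hy ?_ ?_
        · rw [heqr y hy, hdy]; exact hx
        · rw [hdx]; exact hy

theorem Rep.tree_unique {T : (caterpillar m).SearchTree} (h : Rep T t) (h' : Rep T t') : t = t' :=
  h.1.eq_of_desc_eq h'.1 fun x _ => (h.2 x).symm.trans (h'.2 x)

/-- A potential that changes by at most `K` per rotation bounds the rotation distance below. -/
theorem Rep.potential_le_of_walk (hn : 0 < n) (f : CTree m → ℕ) (K : ℕ)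
    (hf : ∀ p c s s', Step p c s s' → f s ≤ f s' + K ∧ f s' ≤ f s + K)
    {T T' : (caterpillar m).SearchTree} (w : (caterpillar m).rotationGraph.Walk T T')
    {t t' : CTree m} (h : Rep T t) (h' : Rep T' t') : f t ≤ f t' + K * w.length := by
  induction w generalizing t with
  | nil => rw [h.tree_unique h']; simp
  | cons hadj w ih =>
    obtain ⟨s, hs, p, c, hstep⟩ := h.exists_step_of_adj hn hadj
    have h1 := ih hs h'
    have h2 : f t ≤ f s + K := hstep.elim (fun h => (hf _ _ _ _ h).1) fun h => (hf _ _ _ _ h).2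
    rw [SimpleGraph.Walk.length_cons, mul_add, mul_one]
    omega

theorem Rep.potential_le (hn : 0 < n) (f : CTree m → ℕ) (K : ℕ)
    (hf : ∀ p c s s', Step p c s s' → f s ≤ f s' + K ∧ f s' ≤ f s + K)
    (hfin : (caterpillar m).rotationGraph.ediam ≠ ⊤)
    (ht : t.Valid 0 n Set.univ) (ht' : t'.Valid 0 n Set.univ) :
    f t ≤ f t' + K * (caterpillar m).rotationGraph.diam := by
  obtain ⟨T, hT⟩ := ht.exists_rep hn
  obtain ⟨T', hT'⟩ := ht'.exists_rep hn
  have : Nonempty (caterpillar m).SearchTree := ⟨T⟩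
  have hconn := SimpleGraph.connected_of_ediam_ne_top hfin
  obtain ⟨w, hw⟩ := hconn.exists_walk_length_eq_dist T T'
  have h1 := hT.potential_le_of_walk hn f K hf w hT'
  rw [hw] at h1
  exact h1.trans (Nat.add_le_add_left (Nat.mul_le_mul_left _ (SimpleGraph.dist_le_diam hfin)) _)

/-- The number of legs that are removed before their spine vertex. -/
def legCount : CTree m → ℕ
  | nil => 0
  | leg _ t => t.legCount + 1
  | sp _ l r => l.legCount + r.legCount

theorem Step.legCount_le (h : Step p c t t') :
    t.legCount ≤ t'.legCount + 1 ∧ t'.legCount ≤ t.legCount + 1 := by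
  induction h <;> simp only [legCount] at * <;> omega

/-- The number of spine vertices on the rightmost path. -/
def rightLength : CTree m → ℕ
  | nil => 0
  | leg _ t => t.rightLength
  | sp _ _ r => r.rightLength + 1

theorem Step.rightLength_le (h : Step p c t t') :
    t.rightLength ≤ t'.rightLength + 1 ∧ t'.rightLength ≤ t.rightLength + 1 := by
  induction h <;> simp only [rightLength] at * <;> omega

/-- The sides (`true` for left) of the nodes with index in `[lo, hi)` on the search path for the
gap before the spine vertex `mid`. -/
def path (lo mid hi : ℕ) : CTree m → List Bool
  | nil => []
  | leg a t => if lo ≤ (a.1 : ℕ) ∧ (a.1 : ℕ) < hi then decide ((a.1 : ℕ) < mid) :: path lo mid hi t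
      else path lo mid hi t
  | sp j l r => if lo ≤ (j : ℕ) ∧ (j : ℕ) < hi then
        decide ((j : ℕ) < mid) :: if (j : ℕ) < mid then path lo mid hi r else path lo mid hi l
      else if (j : ℕ) < mid then path lo mid hi r else path lo mid hi l

/-- The number of maximal constant blocks of a list, where a first block that continues `o` is not
counted. -/
def runs : Option Bool → List Bool → ℕ
  | _, [] => 0
  | o, a :: l => (if o = some a then 0 else 1) + runs (some a) l

theorem runs_le (o o' : Option Bool) (l : List Bool) : runs o l ≤ runs o' l + 1 := by
  cases l with
  | nil => simp [runs]
  | cons a l => simp only [runs]; split_ifs <;> omega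

theorem runs_append_ge (o : Option Bool) (l k : List Bool) : runs o l ≤ runs o (l ++ k) := by
  induction l generalizing o with
  | nil => simp [runs]
  | cons a l ih => simp only [runs, List.cons_append]; have := ih (some a); omega

theorem runs_swap_le (o : Option Bool) (a b : Bool) (l : List Bool) :
    runs o (a :: b :: l) ≤ runs o (b :: a :: l) + 2 := by
  cases a <;> cases b <;> simp only [runs]
  · omega
  · have := runs_le (some true) (some false) l
    simp only [reduceCtorEq, if_false, Option.some.injEq, Bool.false_eq_true]
    split_ifs <;> omega
  · have := runs_le (some false) (some true) l
    simp only [reduceCtorEq, if_false, Option.some.injEq, Bool.true_eq_false]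
    split_ifs <;> omega
  · omega

/-- The indices of `x` and `y` lie in `[lo, hi)`, on different sides of `mid`. -/
def Separated (lo mid hi : ℕ) (x y : Vert m) : Prop :=
  (lo ≤ pos x ∧ pos x < mid ∧ mid ≤ pos y ∧ pos y < hi) ∨
    (lo ≤ pos y ∧ pos y < mid ∧ mid ≤ pos x ∧ pos x < hi)

/-- If `p` and `c` are on the same side, the word changes at most within a constant block; a vertex
outside `[lo, hi)` leaves no letter at all. -/
theorem Step.runs_path_eq (h : Step p c t t') (h1 : lo ≤ mid) (h2 : mid ≤ hi)
    (hsep : ¬ Separated lo mid hi p c) (o : Option Bool) :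
    runs o (t.path lo mid hi) = runs o (t'.path lo mid hi) := by
  induction h generalizing o with
  | congr_leg a h ih =>
    simp only [path]
    split_ifs
    · simp only [runs, ih hsep]
    · exact ih hsep o
  | congr_left j r h ih =>
    simp only [path]
    split_ifs
    · rfl
    · simp only [runs, ih hsep]
    · rfl
    · exact ih hsep o
  | congr_right j r h ih =>
    simp only [path]
    split_ifs
    · simp only [runs, ih hsep]
    · rfl
    · exact ih hsep o
    · rfl
  | spine p c l k r h =>
    simp only [Separated, pos_inl, not_or, not_and, not_lt] at hsep
    simp only [path]
    have h' : (p : ℕ) < c := h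
    by_cases hp : (p : ℕ) < mid <;> by_cases hc : (c : ℕ) < mid <;>
      simp only [hp, hc, if_true, if_false, decide_true, decide_false] <;>
      split_ifs <;> first | rfl | omega | simp [runs]
  | legs a b t =>
    simp only [Separated, pos_inr, not_or, not_and, not_lt] at hsep
    simp only [path]
    by_cases hp : (a.1 : ℕ) < mid <;> by_cases hc : (b.1 : ℕ) < mid <;>
      simp only [hp, hc, decide_true, decide_false] <;>
      split_ifs <;> first | rfl | omega
  | left a c l r h =>
    simp only [Separated, pos_inr, pos_inl, not_or, not_and, not_lt] at hsep
    simp only [path]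
    have h' : (a.1 : ℕ) < c := h
    by_cases hp : (a.1 : ℕ) < mid <;> by_cases hc : (c : ℕ) < mid <;>
      simp only [hp, hc, if_true, if_false, decide_true, decide_false] <;>
      split_ifs <;> first | rfl | omega | simp [runs]
  | right a c l r h =>
    simp only [Separated, pos_inr, pos_inl, not_or, not_and, not_lt] at hsep
    simp only [path]
    have h' : (c : ℕ) < a.1 := h
    by_cases hp : (a.1 : ℕ) < mid <;> by_cases hc : (c : ℕ) < mid <;>
      simp only [hp, hc, if_true, if_false, decide_true, decide_false] <;>
      split_ifs <;> first | rfl | omega | simp [runs]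
  | down a l r =>
    simp only [path]
    by_cases hp : (a.1 : ℕ) < mid <;>
      simp only [hp, if_true, if_false, decide_true, decide_false] <;>
      split_ifs <;> first | rfl | omega | simp [runs]

theorem runs_cons_le {o : Option Bool} {a : Bool} {l k : List Bool} {K : ℕ}
    (h : ∀ o, runs o l ≤ runs o k + K ∧ runs o k ≤ runs o l + K) :
    runs o (a :: l) ≤ runs o (a :: k) + K ∧ runs o (a :: k) ≤ runs o (a :: l) + K := by
  have := h (some a)
  simp only [runs]
  omega

/-- For a separated pair, both vertices are on the search path before and after the rotation, so two
adjacent letters are exchanged. -/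
theorem Step.runs_path_le (h : Step p c t t') (h1 : lo ≤ mid) (h2 : mid ≤ hi)
    (o : Option Bool) : runs o (t.path lo mid hi) ≤ runs o (t'.path lo mid hi) + 2 ∧
      runs o (t'.path lo mid hi) ≤ runs o (t.path lo mid hi) + 2 := by
  by_cases hsep : Separated lo mid hi p c
  swap
  · rw [h.runs_path_eq h1 h2 hsep]; omega
  induction h generalizing o with
  | congr_leg a h ih =>
    simp only [path]
    split_ifs
    · exact runs_cons_le fun o => ih o hsep
    · exact ih o hsep
  | congr_left j r h ih =>
    simp only [path]
    split_ifs
    · omega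
    · exact runs_cons_le fun o => ih o hsep
    · omega
    · exact ih o hsep
  | congr_right j r h ih =>
    simp only [path]
    split_ifs
    · exact runs_cons_le fun o => ih o hsep
    · omega
    · exact ih o hsep
    · omega
  | spine p c l k r h =>
    simp only [Separated, pos_inl] at hsep
    have h' : (p : ℕ) < c := h
    have e1 : (p : ℕ) < mid := by omega
    have e2 : ¬ (c : ℕ) < mid := by omega
    have e3 : lo ≤ (p : ℕ) ∧ (p : ℕ) < hi := by omega
    have e4 : lo ≤ (c : ℕ) ∧ (c : ℕ) < hi := by omega
    simp only [path, e1, e2, e3, e4, if_true, if_false, and_self]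
    exact ⟨runs_swap_le _ _ _ _, runs_swap_le _ _ _ _⟩
  | legs a b t =>
    simp only [Separated, pos_inr] at hsep
    have e3 : lo ≤ (a.1 : ℕ) ∧ (a.1 : ℕ) < hi := by omega
    have e4 : lo ≤ (b.1 : ℕ) ∧ (b.1 : ℕ) < hi := by omega
    simp only [path, e3, e4, if_true, and_self]
    exact ⟨runs_swap_le _ _ _ _, runs_swap_le _ _ _ _⟩
  | left a c l r h =>
    simp only [Separated, pos_inl, pos_inr] at hsep
    have h' : (a.1 : ℕ) < c := h
    have e1 : (a.1 : ℕ) < mid := by omega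
    have e2 : ¬ (c : ℕ) < mid := by omega
    have e3 : lo ≤ (a.1 : ℕ) ∧ (a.1 : ℕ) < hi := by omega
    have e4 : lo ≤ (c : ℕ) ∧ (c : ℕ) < hi := by omega
    simp only [path, e1, e2, e3, e4, if_true, if_false, and_self]
    exact ⟨runs_swap_le _ _ _ _, runs_swap_le _ _ _ _⟩
  | right a c l r h =>
    simp only [Separated, pos_inl, pos_inr] at hsep
    have h' : (c : ℕ) < a.1 := h
    have e1 : ¬ (a.1 : ℕ) < mid := by omega
    have e2 : (c : ℕ) < mid := by omega
    have e3 : lo ≤ (a.1 : ℕ) ∧ (a.1 : ℕ) < hi := by omega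
    have e4 : lo ≤ (c : ℕ) ∧ (c : ℕ) < hi := by omega
    simp only [path, e1, e2, e3, e4, if_true, and_self]
    exact ⟨runs_swap_le _ _ _ _, runs_swap_le _ _ _ _⟩
  | down a l r =>
    simp only [Separated, pos_inl, pos_inr] at hsep
    omega

end CTree

/-! ### Leg weights, reference trees and the alternating leg order. -/

/-- The number of legs at the spine index `i`, zero beyond the spine. -/
def legsAt {n : ℕ} (m : Fin n → ℕ) (i : ℕ) : ℕ := if h : i < n then m ⟨i, h⟩ else 0

/-- The number of legs with spine index in `[lo, hi)`. -/
def weight {n : ℕ} (m : Fin n → ℕ) (lo hi : ℕ) : ℕ := ∑ i ∈ Finset.Ico lo hi, legsAt m i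

@[simp] theorem legsAt_fin (i : Fin n) : legsAt m i = m i := by simp [legsAt]

theorem weight_split {lo hi x : ℕ} (h1 : lo ≤ x) (h2 : x < hi) :
    weight m lo hi = weight m lo x + legsAt m x + weight m (x + 1) hi := by
  unfold weight
  rw [← Finset.sum_Ico_consecutive _ h1 h2.le, Finset.sum_eq_sum_Ico_succ_bot h2, add_assoc]

theorem weight_zero_n : weight m 0 n = ∑ i, m i := by
  rw [weight, ← Finset.range_eq_Ico, ← Fin.sum_univ_eq_sum_range]
  simp

theorem weight_eq_zero {lo hi : ℕ} (h : weight m lo hi = 0) {i : ℕ} (h1 : lo ≤ i) (h2 : i < hi) :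
    legsAt m i = 0 :=
  Finset.sum_eq_zero_iff.1 h i (Finset.mem_Ico.2 ⟨h1, h2⟩)

theorem weight_self (lo : ℕ) : weight m lo lo = 0 := by simp [weight]

/-- Binary trees on intervals of spine indices. -/
inductive RefTree where
  | leaf : RefTree
  | node (x : ℕ) (L R : RefTree) : RefTree

namespace RefTree

/-- The tree is a binary search tree on a set of indices in `[lo, hi)` that includes all indices
with legs. -/
def Valid {n : ℕ} (m : Fin n → ℕ) : RefTree → ℕ → ℕ → Prop
  | leaf, lo, hi => weight m lo hi = 0
  | node x L R, lo, hi => lo ≤ x ∧ x < hi ∧ L.Valid m lo x ∧ R.Valid m (x + 1) hi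

/-- The number of nodes. -/
def size : RefTree → ℕ
  | leaf => 0
  | node _ L R => L.size + R.size + 1

/-- The sum over all nodes of the smaller one of the numbers of legs on the two sides. -/
def score {n : ℕ} (m : Fin n → ℕ) : RefTree → ℕ → ℕ → ℕ
  | leaf, _, _ => 0
  | node x L R, lo, hi => min (weight m lo x) (weight m (x + 1) hi) + L.score m lo x +
      R.score m (x + 1) hi

theorem Valid.size_le {P : RefTree} {lo hi : ℕ} (h : P.Valid m lo hi) : P.size ≤ hi - lo := by
  induction P generalizing lo hi with
  | leaf => simp [size]
  | node x L R ihL ihR =>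
    obtain ⟨h1, h2, h3, h4⟩ := h
    have := ihL h3
    have := ihR h4
    simp only [size]
    omega

end RefTree

/-- Alternates between the elements of two lists as long as possible. -/
def interleave {α : Type*} : List α → List α → List α
  | [], k => k
  | a :: l, [] => a :: l
  | a :: l, b :: k => a :: b :: interleave l k

theorem interleave_perm {α : Type*} (l k : List α) : (interleave l k).Perm (l ++ k) := by
  induction l generalizing k with
  | nil => simp [interleave]
  | cons a l ih =>
    cases k with
    | nil => simp [interleave]
    | cons b k =>
      simp only [interleave, List.cons_append]
      refine List.Perm.cons a ?_
      exact ((ih k).cons b).trans List.perm_middle.symm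

theorem filter_interleave_left {α : Type*} (f : α → Bool) (l k : List α)
    (hl : ∀ a ∈ l, f a = true) (hk : ∀ a ∈ k, f a = false) : (interleave l k).filter f = l := by
  induction l generalizing k with
  | nil => simpa [interleave] using hk
  | cons a l ih =>
    cases k with
    | nil => simpa [interleave] using hl
    | cons b k =>
      simp only [List.forall_mem_cons] at hl hk
      simp [interleave, hl.1, hk.1, ih k hl.2 hk.2]

theorem filter_interleave_right {α : Type*} (f : α → Bool) (l k : List α)
    (hl : ∀ a ∈ l, f a = false) (hk : ∀ a ∈ k, f a = true) : (interleave l k).filter f = k := by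
  induction l generalizing k with
  | nil => simpa [interleave] using hk
  | cons a l ih =>
    cases k with
    | nil => simpa [interleave] using hl
    | cons b k =>
      simp only [List.forall_mem_cons] at hl hk
      simp [interleave, hl.1, hk.1, ih k hl.2 hk.2]

namespace CTree

theorem min_length_le_runs {α : Type*} (f : α → Bool) (l k : List α) (o : Option Bool)
    (hl : ∀ a ∈ l, f a = true) (hk : ∀ a ∈ k, f a = false) :
    min l.length k.length ≤ runs o ((interleave l k).map f) := by
  induction l generalizing k o with
  | nil => simp
  | cons a l ih =>
    cases k with
    | nil => simp
    | cons b k =>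
      simp only [List.forall_mem_cons] at hl hk
      have := ih k (some false) hl.2 hk.2
      simp only [interleave, List.map_cons, hl.1, hk.1, runs, List.length_cons]
      simp only [Option.some.injEq, Bool.true_eq_false, if_false]
      omega

end CTree

/-- The list of the legs at the spine index `x`. -/
def legList {n : ℕ} (m : Fin n → ℕ) (x : ℕ) : List ((i : Fin n) × Fin (m i)) :=
  if h : x < n then (List.finRange (m ⟨x, h⟩)).map (Sigma.mk ⟨x, h⟩) else []

theorem length_legList (x : ℕ) : (legList m x).length = legsAt m x := by
  unfold legList legsAt
  split_ifs <;> simp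

theorem pos_of_mem_legList {x : ℕ} {a : (i : Fin n) × Fin (m i)} (h : a ∈ legList m x) :
    (a.1 : ℕ) = x := by
  unfold legList at h
  split_ifs at h with hx
  · obtain ⟨k, -, rfl⟩ := List.mem_map.1 h
    rfl
  · simp at h

theorem nodup_legList (x : ℕ) : (legList m x).Nodup := by
  unfold legList
  split_ifs with hx
  · exact (List.nodup_finRange _).map sigma_mk_injective
  · simp

namespace RefTree

/-- An order of the legs in which, at each node of the reference tree, the legs on the two sides
alternate as long as possible. -/
def legOrder {n : ℕ} (m : Fin n → ℕ) : RefTree → List ((i : Fin n) × Fin (m i))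
  | leaf => []
  | node x L R => interleave (L.legOrder m) (R.legOrder m) ++ legList m x

variable {P : RefTree} {lo hi : ℕ}

theorem Valid.pos_of_mem (h : P.Valid m lo hi) {a : (i : Fin n) × Fin (m i)}
    (ha : a ∈ P.legOrder m) : lo ≤ (a.1 : ℕ) ∧ (a.1 : ℕ) < hi := by
  induction P generalizing lo hi with
  | leaf => simp [legOrder] at ha
  | node x L R ihL ihR =>
    obtain ⟨h1, h2, h3, h4⟩ := h
    simp only [legOrder, List.mem_append, (interleave_perm _ _).mem_iff] at ha
    rcases ha with (ha | ha) | ha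
    · have := ihL h3 ha; omega
    · have := ihR h4 ha; omega
    · have := pos_of_mem_legList ha; omega

theorem Valid.length_legOrder (h : P.Valid m lo hi) : (P.legOrder m).length = weight m lo hi := by
  induction P generalizing lo hi with
  | leaf =>
    have : weight m lo hi = 0 := h
    simp [legOrder, this]
  | node x L R ihL ihR =>
    obtain ⟨h1, h2, h3, h4⟩ := h
    rw [weight_split h1 h2, legOrder, List.length_append, (interleave_perm _ _).length_eq,
      List.length_append, ihL h3, ihR h4, length_legList]
    omega

theorem Valid.nodup_legOrder (h : P.Valid m lo hi) : (P.legOrder m).Nodup := by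
  induction P generalizing lo hi with
  | leaf => simp [legOrder]
  | node x L R ihL ihR =>
    obtain ⟨h1, h2, h3, h4⟩ := h
    rw [legOrder, List.nodup_append', (interleave_perm _ _).nodup_iff, List.nodup_append']
    refine ⟨⟨ihL h3, ihR h4, ?_⟩, nodup_legList x, ?_⟩
    · intro a ha hb
      have := h3.pos_of_mem ha
      have := h4.pos_of_mem hb
      omega
    · intro a ha hb
      rw [(interleave_perm _ _).mem_iff, List.mem_append] at ha
      have := pos_of_mem_legList hb
      rcases ha with ha | ha
      · have := h3.pos_of_mem ha; omega
      · have := h4.pos_of_mem ha; omega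

end RefTree

/-! ### Lower bounds on the diameter. -/

namespace CTree

variable {t t' l r : CTree m} {lo mid hi : ℕ} {A B : Set ((i : Fin n) × Fin (m i))}
  {x y p c : Vert m}

/-- The sum over the nodes of a reference tree of the number of runs of the search path. -/
def runSum : RefTree → ℕ → ℕ → CTree m → ℕ
  | .leaf, _, _, _ => 0
  | .node x L R, lo, hi, t => runs none (t.path lo x hi) + runSum L lo x t + runSum R (x + 1) hi t

theorem Step.runSum_eq {P : RefTree} (hP : P.Valid m lo hi) (h : Step p c t t')
    (hout : ¬ (lo ≤ pos p ∧ pos p < hi ∧ lo ≤ pos c ∧ pos c < hi)) :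
    runSum P lo hi t = runSum P lo hi t' := by
  induction P generalizing lo hi with
  | leaf => rfl
  | node x L R ihL ihR =>
    obtain ⟨h1, h2, h3, h4⟩ := hP
    simp only [runSum]
    rw [h.runs_path_eq h1 h2.le (by unfold Separated; omega), ihL h3 (by omega),
      ihR h4 (by omega)]

/-- At a reference node that separates `p` from `c`, neither subinterval contains both, so the
deeper nodes do not change. Otherwise at most one subinterval contains both, and the change is
confined to it. So the bound 2 does not add up over the nodes. -/
theorem Step.runSum_le {P : RefTree} (hP : P.Valid m lo hi) (h : Step p c t t') :
    runSum P lo hi t ≤ runSum P lo hi t' + 2 ∧ runSum P lo hi t' ≤ runSum P lo hi t + 2 := by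
  induction P generalizing lo hi with
  | leaf => simp [runSum]
  | node x L R ihL ihR =>
    obtain ⟨h1, h2, h3, h4⟩ := hP
    simp only [runSum]
    by_cases hsep : Separated lo x hi p c
    · have := h.runs_path_le h1 h2.le none
      unfold Separated at hsep
      rw [h.runSum_eq h3 (by omega), h.runSum_eq h4 (by omega)]
      omega
    · rw [h.runs_path_eq h1 h2.le hsep]
      by_cases hL : lo ≤ pos p ∧ pos p < x ∧ lo ≤ pos c ∧ pos c < x
      · have := ihL h3
        rw [h.runSum_eq h4 (by omega)]
        omega
      · have := ihR h4
        rw [h.runSum_eq h3 hL]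
        omega

/-- The legs in `s`, in this order, are removed before the tree `t`. -/
def stack (s : List ((i : Fin n) × Fin (m i))) (t : CTree m) : CTree m := s.foldr leg t

theorem path_stack (s : List ((i : Fin n) × Fin (m i))) (t : CTree m) :
    (stack s t).path lo mid hi =
      (s.filter fun a => decide (lo ≤ (a.1 : ℕ) ∧ (a.1 : ℕ) < hi)).map
        (fun a => decide ((a.1 : ℕ) < mid)) ++ t.path lo mid hi := by
  induction s with
  | nil => rfl
  | cons a s ih =>
    simp only [stack, List.foldr_cons, path] at ih ⊢
    rw [ih]
    split_ifs with h <;> simp [h]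

theorem legCount_stack (s : List ((i : Fin n) × Fin (m i))) (t : CTree m) :
    (stack s t).legCount = s.length + t.legCount := by
  induction s with
  | nil => simp [stack]
  | cons a s ih =>
    simp only [stack, List.foldr_cons, legCount, List.length_cons] at ih ⊢
    omega

theorem valid_stack {s : List ((i : Fin n) × Fin (m i))} (hs : s.Nodup)
    (hpos : ∀ a ∈ s, lo ≤ (a.1 : ℕ) ∧ (a.1 : ℕ) < hi ∧ a ∈ A) (ht : ∀ A, t.Valid lo hi A) :
    (stack s t).Valid lo hi A := by
  induction s generalizing A with
  | nil => exact ht A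
  | cons a s ih =>
    rw [List.nodup_cons] at hs
    rw [List.forall_mem_cons] at hpos
    refine ⟨hpos.1.1, hpos.1.2.1, hpos.1.2.2, ih hs.2 fun b hb => ?_⟩
    obtain ⟨h1, h2, h3⟩ := hpos.2 b hb
    exact ⟨h1, h2, h3, fun h => hs.1 (h ▸ hb)⟩

/-- Interleaving keeps the internal order of each side, so restricting the stack to a subinterval
recovers the leg order of that subtree. One stack thus alternates well at all reference nodes at
once. -/
theorem score_le_runSum {P : RefTree} (hP : P.Valid m lo hi)
    (s : List ((i : Fin n) × Fin (m i)))
    (hs : (s.filter fun a => decide (lo ≤ (a.1 : ℕ) ∧ (a.1 : ℕ) < hi)) = P.legOrder m) :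
    P.score m lo hi ≤ runSum P lo hi (stack s t) := by
  induction P generalizing lo hi with
  | leaf => simp [RefTree.score]
  | node x L R ihL ihR =>
    obtain ⟨h1, h2, h3, h4⟩ := hP
    simp only [RefTree.score, runSum]
    have hfL : (s.filter fun a => decide (lo ≤ (a.1 : ℕ) ∧ (a.1 : ℕ) < x)) = L.legOrder m := by
      have : (s.filter fun a => decide (lo ≤ (a.1 : ℕ) ∧ (a.1 : ℕ) < x)) =
          (s.filter fun a => decide (lo ≤ (a.1 : ℕ) ∧ (a.1 : ℕ) < hi)).filter
            fun a => decide (lo ≤ (a.1 : ℕ) ∧ (a.1 : ℕ) < x) := by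
        rw [List.filter_filter]
        apply List.filter_congr
        intro a _
        rw [Bool.eq_iff_iff]
        simp only [decide_eq_true_eq, Bool.and_eq_true]
        omega
      rw [this, hs, RefTree.legOrder, List.filter_append, filter_interleave_left,
        List.filter_eq_nil_iff.2, List.append_nil]
      · intro a ha
        have := pos_of_mem_legList ha
        simp; omega
      · intro a ha
        have := h3.pos_of_mem ha
        simp; omega
      · intro a ha
        have := h4.pos_of_mem ha
        simp; omega
    have hfR : (s.filter fun a => decide (x + 1 ≤ (a.1 : ℕ) ∧ (a.1 : ℕ) < hi)) =
        R.legOrder m := by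
      have : (s.filter fun a => decide (x + 1 ≤ (a.1 : ℕ) ∧ (a.1 : ℕ) < hi)) =
          (s.filter fun a => decide (lo ≤ (a.1 : ℕ) ∧ (a.1 : ℕ) < hi)).filter
            fun a => decide (x + 1 ≤ (a.1 : ℕ) ∧ (a.1 : ℕ) < hi) := by
        rw [List.filter_filter]
        apply List.filter_congr
        intro a _
        rw [Bool.eq_iff_iff]
        simp only [decide_eq_true_eq, Bool.and_eq_true]
        omega
      rw [this, hs, RefTree.legOrder, List.filter_append, filter_interleave_right,
        List.filter_eq_nil_iff.2, List.append_nil]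
      · intro a ha
        have := pos_of_mem_legList ha
        simp; omega
      · intro a ha
        have := h3.pos_of_mem ha
        simp; omega
      · intro a ha
        have := h4.pos_of_mem ha
        simp; omega
    have hmin : min (weight m lo x) (weight m (x + 1) hi) ≤
        runs none ((stack s t).path lo x hi) := by
      rw [path_stack, hs, RefTree.legOrder, List.map_append, List.append_assoc,
        ← h3.length_legOrder, ← h4.length_legOrder]
      refine (min_length_le_runs _ _ _ none ?_ ?_).trans (runs_append_ge _ _ _)
      · intro a ha
        have := h3.pos_of_mem ha
        simp; omega
      · intro a ha
        have := h4.pos_of_mem ha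
        simp; omega
    have := ihL h3 hfL
    have := ihR h4 hfR
    omega

/-- Paths of spine vertices in increasing order. -/
inductive IsComb : CTree m → Prop
  | nil : IsComb nil
  | sp (j r) (h : IsComb r) : IsComb (sp j .nil r)

theorem exists_isComb (k lo : ℕ) (h : lo + k ≤ n) : ∃ t : CTree m, t.IsComb ∧
    (∀ A, t.Valid lo (lo + k) A) ∧ t.rightLength = k ∧ t.legCount = 0 := by
  induction k generalizing lo with
  | zero => exact ⟨nil, .nil, fun _ => le_rfl, rfl, rfl⟩
  | succ k ih =>
    obtain ⟨t, h1, h2, h3, h4⟩ := ih (lo + 1) (by omega)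
    refine ⟨sp ⟨lo, by omega⟩ nil t, .sp _ _ h1, fun A => ⟨le_rfl, by simp, le_rfl, ?_⟩, ?_, ?_⟩
    · have := h2 A
      rwa [add_right_comm] at this
    · simp [rightLength, h3]
    · simp [legCount, h4]

theorem exists_rightLength_eq_one (k : ℕ) (h : k ≤ n) (A : Set ((i : Fin n) × Fin (m i))) :
    ∃ t : CTree m, t.Valid 0 k A ∧ t.rightLength ≤ 1 := by
  induction k with
  | zero => exact ⟨nil, le_rfl, by simp [rightLength]⟩
  | succ k ih =>
    obtain ⟨t, h1, -⟩ := ih (by omega)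
    exact ⟨sp ⟨k, by omega⟩ t nil, ⟨by simp, by simp, h1, le_rfl⟩, by simp [rightLength]⟩

/-- The path goes right through the indices below `mid` and ends at the first one not below, whose
left subtree is empty. -/
theorem IsComb.runs_path_le (h : t.IsComb) : runs (some true) (t.path lo mid hi) ≤ 1 := by
  induction h with
  | nil => simp [path, runs]
  | sp j r h ih =>
    simp only [path]
    by_cases hj : (j : ℕ) < mid
    · simp only [hj, if_true, decide_true]
      split_ifs
      · simpa [runs] using ih
      · exact ih
    · simp only [hj, if_false, decide_false]
      split_ifs <;> simp [runs]

theorem IsComb.runSum_le (h : t.IsComb) (P : RefTree) (lo hi : ℕ) :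
    runSum P lo hi t ≤ 2 * P.size := by
  induction P generalizing lo hi with
  | leaf => simp [runSum]
  | node x L R ihL ihR =>
    simp only [runSum, RefTree.size]
    have h1 := runs_le none (some true) (t.path lo x hi)
    have h2 := h.runs_path_le (lo := lo) (mid := x) (hi := hi)
    have := ihL lo x
    have := ihR (x + 1) hi
    omega

theorem score_le_diam (hn : 0 < n) (hfin : (caterpillar m).rotationGraph.ediam ≠ ⊤)
    {P : RefTree} (hP : P.Valid m 0 n) :
    P.score m 0 n ≤ 2 * n + 2 * (caterpillar m).rotationGraph.diam := by
  obtain ⟨t, ht, htv, -, -⟩ := exists_isComb (m := m) n 0 (by omega)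
  rw [zero_add] at htv
  have hsv : (stack (P.legOrder m) t).Valid 0 n Set.univ :=
    valid_stack hP.nodup_legOrder (fun a ha => ⟨by omega, a.1.2, trivial⟩) htv
  have h1 := Rep.potential_le hn (runSum P 0 n) 2 (fun p c s s' h => h.runSum_le hP) hfin hsv
    (htv Set.univ)
  have h2 := score_le_runSum (t := t) hP (P.legOrder m) (List.filter_eq_self.2 fun a _ => by simp)
  have h3 := ht.runSum_le P 0 n
  have h4 := hP.size_le
  omega

theorem weight_le_diam (hn : 0 < n) (hfin : (caterpillar m).rotationGraph.ediam ≠ ⊤)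
    {P : RefTree} (hP : P.Valid m 0 n) :
    ∑ i, m i ≤ (caterpillar m).rotationGraph.diam := by
  obtain ⟨t, ht, htv, -, ht0⟩ := exists_isComb (m := m) n 0 (by omega)
  rw [zero_add] at htv
  have hsv : (stack (P.legOrder m) t).Valid 0 n Set.univ :=
    valid_stack hP.nodup_legOrder (fun a ha => ⟨by omega, a.1.2, trivial⟩) htv
  have h1 := Rep.potential_le hn legCount 1 (fun p c s s' h => h.legCount_le) hfin hsv
    (htv Set.univ)
  rw [legCount_stack, hP.length_legOrder, weight_zero_n] at h1
  omega

/-- The increasing and the decreasing spine path are compared. -/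
theorem spine_le_diam (hn : 0 < n) (hfin : (caterpillar m).rotationGraph.ediam ≠ ⊤) :
    n ≤ (caterpillar m).rotationGraph.diam + 1 := by
  obtain ⟨t, -, htv, htn, -⟩ := exists_isComb (m := m) n 0 (by omega)
  rw [zero_add] at htv
  obtain ⟨t', ht', h1⟩ := exists_rightLength_eq_one (m := m) n le_rfl Set.univ
  have := Rep.potential_le hn rightLength 1 (fun p c s s' h => h.rightLength_le) hfin
    (htv Set.univ) ht'
  omega

end CTree

/-! ### Upper bound: rotation sequences and the amortized pivot. -/

namespace CTree

variable {t t' s l r : CTree m} {lo mid hi : ℕ} {A B : Set ((i : Fin n) × Fin (m i))}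
  {x y p c : Vert m}

/-- One rotation, in a direction that preserves validity. -/
def Move (t t' : CTree m) : Prop :=
  (∃ p c, Step p c t t' ∨ Step p c t' t) ∧ ∀ lo hi A, t.Valid lo hi A → t'.Valid lo hi A

theorem Step.move (h : Step p c t t') : Move t t' :=
  ⟨⟨p, c, Or.inl h⟩, fun _ _ _ ht => h.valid ht⟩

theorem Move.congr_leg (a : (i : Fin n) × Fin (m i)) (h : Move t t') :
    Move (leg a t) (leg a t') := by
  obtain ⟨⟨p, c, h1⟩, h2⟩ := h
  exact ⟨⟨p, c, h1.imp (Step.congr_leg a) (Step.congr_leg a)⟩,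
    fun lo hi A ht => ⟨ht.1, ht.2.1, ht.2.2.1, h2 _ _ _ ht.2.2.2⟩⟩

theorem Move.congr_left (j : Fin n) (r : CTree m) (h : Move t t') :
    Move (sp j t r) (sp j t' r) := by
  obtain ⟨⟨p, c, h1⟩, h2⟩ := h
  exact ⟨⟨p, c, h1.imp (Step.congr_left j r) (Step.congr_left j r)⟩,
    fun lo hi A ht => ⟨ht.1, ht.2.1, h2 _ _ _ ht.2.2.1, ht.2.2.2⟩⟩

theorem Move.congr_right (j : Fin n) (l : CTree m) (h : Move t t') :
    Move (sp j l t) (sp j l t') := by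
  obtain ⟨⟨p, c, h1⟩, h2⟩ := h
  exact ⟨⟨p, c, h1.imp (Step.congr_right j l) (Step.congr_right j l)⟩,
    fun lo hi A ht => ⟨ht.1, ht.2.1, ht.2.2.1, h2 _ _ _ ht.2.2.2⟩⟩

theorem move_rotate_right {p c : Fin n} (h : c < p) (l k r : CTree m) :
    Move (sp p (sp c l k) r) (sp c l (sp p k r)) := by
  refine ⟨⟨_, _, Or.inr (Step.spine c p l k r h)⟩, fun lo hi A ht => ?_⟩
  obtain ⟨h1, h2, ⟨h3, h4, h5, h6⟩, h7⟩ := ht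
  exact ⟨h3, by omega, h5, h4, h2, h6, h7⟩

/-- `t'` is reached from `t` by `k` moves. -/
inductive Reach : ℕ → CTree m → CTree m → Prop
  | refl (t : CTree m) : Reach 0 t t
  | head {k : ℕ} {t s t' : CTree m} (h : Move t s) (h' : Reach k s t') : Reach (k + 1) t t'

theorem Reach.trans {k k' : ℕ} (h : Reach k t s) (h' : Reach k' s t') : Reach (k + k') t t' := by
  induction h with
  | refl t => rwa [zero_add]
  | head h _ ih => rw [add_right_comm]; exact .head h (ih h')

theorem Reach.tail {k : ℕ} (h : Reach k t s) (h' : Move s t') : Reach (k + 1) t t' :=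
  h.trans (.head h' (.refl _))

theorem Reach.valid {k : ℕ} (h : Reach k t t') (ht : t.Valid lo hi A) : t'.Valid lo hi A := by
  induction h with
  | refl t => exact ht
  | head h _ ih => exact ih (h.2 _ _ _ ht)

theorem Reach.congr_leg {k : ℕ} (a : (i : Fin n) × Fin (m i)) (h : Reach k t t') :
    Reach k (leg a t) (leg a t') := by
  induction h with
  | refl t => exact .refl _
  | head h _ ih => exact .head (h.congr_leg a) ih

theorem Reach.congr_left {k : ℕ} (j : Fin n) (r : CTree m) (h : Reach k t t') :
    Reach k (sp j t r) (sp j t' r) := by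
  induction h with
  | refl t => exact .refl _
  | head h _ ih => exact .head (h.congr_left j r) ih

theorem Reach.congr_right {k : ℕ} (j : Fin n) (l : CTree m) (h : Reach k t t') :
    Reach k (sp j l t) (sp j l t') := by
  induction h with
  | refl t => exact .refl _
  | head h _ ih => exact .head (h.congr_right j l) ih

theorem Reach.exists_walk (hn : 0 < n) {k : ℕ} (h : Reach k t t')
    {T : (caterpillar m).SearchTree} (hT : Rep T t) :
    ∃ (T' : (caterpillar m).SearchTree) (w : (caterpillar m).rotationGraph.Walk T T'),
      Rep T' t' ∧ w.length = k := by
  induction h generalizing T with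
  | refl t => exact ⟨T, .nil, hT, rfl⟩
  | head h _ ih =>
    obtain ⟨⟨p, c, hs⟩, hv⟩ := h
    obtain ⟨S, hS⟩ := (hv _ _ _ hT.1).exists_rep hn
    obtain ⟨T', w, hT', hw⟩ := ih hS
    have hadj : (caterpillar m).rotationGraph.Adj T S :=
      hs.elim (fun hs => hT.adj_of_step hS hs) fun hs => (hS.adj_of_step hT hs).symm
    exact ⟨T', .cons hadj w, hT', by simp [hw]⟩

/-- The number of explicit legs and of spine vertices with legs. -/
def load : CTree m → ℕ
  | nil => 0
  | leg _ t => t.load + 1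
  | sp j l r => (if m j = 0 then 0 else 1) + l.load + r.load

/-- The number of spine vertices without legs that have a node counted by `load` below them. -/
def bare : CTree m → ℕ
  | nil => 0
  | leg _ t => t.bare
  | sp j l r => (if m j = 0 ∧ 0 < l.load + r.load then 1 else 0) + l.bare + r.bare

/-- Indicates that the root is a spine vertex without legs and that its left subtree has load
zero. -/
def bareLeft : CTree m → ℕ
  | nil => 0
  | leg _ _ => 0
  | sp j l _ => if m j = 0 ∧ l.load = 0 then 1 else 0

/-- Indicates that the root is a spine vertex without legs and that its right subtree has load
zero. -/
def bareRight : CTree m → ℕ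
  | nil => 0
  | leg _ _ => 0
  | sp j _ r => if m j = 0 ∧ r.load = 0 then 1 else 0

/-- The number of spine vertices. -/
def size : CTree m → ℕ
  | nil => 0
  | leg _ t => t.size
  | sp _ l r => l.size + r.size + 1

theorem bareLeft_le (t : CTree m) : t.bareLeft ≤ 1 := by
  cases t <;> simp only [bareLeft] <;> (try split_ifs) <;> omega

theorem bareRight_le (t : CTree m) : t.bareRight ≤ 1 := by
  cases t <;> simp only [bareRight] <;> (try split_ifs) <;> omega

theorem bare_le_size (t : CTree m) : t.bare ≤ t.size := by
  induction t with
  | nil => simp [bare]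
  | leg a t ih => simpa [bare, size] using ih
  | sp j l r ihl ihr => simp only [bare, size]; split_ifs <;> omega

theorem Valid.size_le (h : t.Valid lo hi A) : t.size ≤ hi - lo := by
  induction t generalizing lo hi A with
  | nil => simp [size]
  | leg a t ih => exact ih h.2.2.2
  | sp j l r ihl ihr =>
    obtain ⟨h1, h2, h3, h4⟩ := h
    have := ihl h3
    have := ihr h4
    simp only [size]
    omega

/-- Ensures that every spine vertex without legs above a pivot with legs is counted by `bare`. -/
theorem Valid.load_pos (h : t.Valid lo hi A) {x : Fin n} (h1 : lo ≤ (x : ℕ)) (h2 : (x : ℕ) < hi)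
    (hx : 0 < m x) : 0 < t.load := by
  induction t generalizing lo hi A with
  | nil => have : hi ≤ lo := h; omega
  | leg a t ih => simp [load]
  | sp j l r ihl ihr =>
    obtain ⟨-, -, h3, h4⟩ := h
    simp only [load]
    rcases lt_trichotomy (x : ℕ) j with hj | hj | hj
    · have := ihl h3 h1 hj; omega
    · obtain rfl := Fin.ext hj
      rw [if_neg hx.ne']; omega
    · have := ihr h4 hj h2; omega

/-- Rotating a spine vertex with legs to the root, with an amortized bound on the cost. -/
theorem Valid.exists_reach_root (h : t.Valid lo hi A) {x : Fin n} (h1 : lo ≤ (x : ℕ))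
    (h2 : (x : ℕ) < hi) (hx : 0 < m x) : ∃ k l r, Reach k t (sp x l r) ∧
      k + 2 * l.bare + 2 * r.bare ≤ 2 * t.load + 2 * t.bare + l.bareLeft + r.bareRight := by
  induction t generalizing lo hi A with
  | nil => have : hi ≤ lo := h; omega
  | leg a t ih =>
    obtain ⟨k, l, r, hk, hle⟩ := ih h.2.2.2 h1 h2
    have hr := hk.congr_leg a
    have hl1 := bareLeft_le l
    have hr1 := bareRight_le r
    simp only [load, bare]
    -- The leg `a` brings 2 units of `2 * load`: one for its rotation, one for the indicator that
    -- may be lost at the new root of its side.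
    rcases lt_trichotomy a.1 x with hax | rfl | hax
    · refine ⟨k + 1, leg a l, r, hr.tail (Step.left a x l r hax).move, ?_⟩
      simp only [bare, bareLeft]; omega
    · exact ⟨k + 1, l, r, hr.tail (Step.down a l r).move, by omega⟩
    · refine ⟨k + 1, l, leg a r, hr.tail (Step.right a x l r hax).move, ?_⟩
      simp only [bare, bareRight]; omega
  | sp j l₀ r₀ ihl ihr =>
    obtain ⟨hj1, hj2, hl, hr⟩ := h
    rcases lt_trichotomy j x with hjx | rfl | hjx
    · have hpos := hr.load_pos hjx h2 hx
      obtain ⟨k, l, r, hk, hle⟩ := ihr hr hjx h2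
      have hl1 := bareLeft_le l
      have hreach : Reach (k + 1) (sp j l₀ r₀) (sp x (sp j l₀ l) r) :=
        (hk.congr_right j l₀).tail (Step.spine j x l₀ l r hjx).move
      -- Here `j` and the root `j'` of `l` both lack legs and have load-free left subtrees. One
      -- extra rotation puts `j` below `j'` into a load-free subtree, where `bare` does not count
      -- it; the drop of `2 * bare` pays for both rotations.
      by_cases hmerge : (m j = 0 ∧ l₀.load = 0) ∧ l.bareLeft = 1
      · obtain ⟨⟨hj0, hl0⟩, hb⟩ := hmerge
        cases l with
        | nil => simp [bareLeft] at hb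
        | leg a l => simp [bareLeft] at hb
        | sp j' l₁ l₂ =>
          have hj' : m j' = 0 ∧ l₁.load = 0 := by
            by_contra hcon
            simp [bareLeft, hcon] at hb
          have hv : (j : ℕ) + 1 ≤ j' := (hk.valid hr).2.2.1.1
          refine ⟨k + 1 + 1, sp j' (sp j l₀ l₁) l₂, r,
            hreach.tail (((Step.spine j j' l₀ l₁ l₂ hv).move).congr_left x r), ?_⟩
          simp only [bare, bareLeft, load, hj0, hl0, hj'.1, hj'.2, true_and, zero_add, if_true,
            lt_irrefl, if_false, and_self] at hle ⊢
          rw [if_pos hpos]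
          omega
      -- Either the indicator `bareLeft` rises from 0 to 1 and pays for the rotation, or the load of
      -- `j` or of `l₀` supplies 2 units, for the rotation and for a possible loss of the indicator.
      · refine ⟨k + 1, sp j l₀ l, r, hreach, ?_⟩
        simp only [bare, bareLeft, load]
        by_cases hj0 : m j = 0
        · by_cases hl0 : l₀.load = 0
          · have hb : l.bareLeft = 0 := by
              by_contra hcon
              exact hmerge ⟨⟨hj0, hl0⟩, by omega⟩
            simp only [hj0, hl0, true_and, if_true, zero_add, and_self]
            rw [if_pos hpos]
            split_ifs <;> omega
          · simp only [hj0, hl0, true_and, if_true, and_false, if_false]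
            rw [if_pos (by omega)]
            split_ifs <;> omega
        · simp only [hj0, false_and, if_false]
          omega
    · exact ⟨0, l₀, r₀, .refl _, by simp only [bare]; omega⟩
    · have hpos := hl.load_pos h1 hjx hx
      obtain ⟨k, l, r, hk, hle⟩ := ihl hl h1 hjx
      have hr1 := bareRight_le r
      have hreach : Reach (k + 1) (sp j l₀ r₀) (sp x l (sp j r r₀)) :=
        (hk.congr_left j r₀).tail (move_rotate_right hjx l r r₀)
      by_cases hmerge : (m j = 0 ∧ r₀.load = 0) ∧ r.bareRight = 1
      · obtain ⟨⟨hj0, hr0⟩, hb⟩ := hmerge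
        cases r with
        | nil => simp [bareRight] at hb
        | leg a r => simp [bareRight] at hb
        | sp j' r₁ r₂ =>
          have hj' : m j' = 0 ∧ r₂.load = 0 := by
            by_contra hcon
            simp [bareRight, hcon] at hb
          have hv : (j' : ℕ) < j := (hk.valid hl).2.2.2.2.1
          refine ⟨k + 1 + 1, l, sp j' r₁ (sp j r₂ r₀),
            hreach.tail ((move_rotate_right hv r₁ r₂ r₀).congr_right x l), ?_⟩
          simp only [bare, bareRight, load, hj0, hr0, hj'.1, hj'.2, true_and, zero_add, add_zero,
            if_true, lt_irrefl, if_false, and_self] at hle ⊢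
          rw [if_pos hpos]
          omega
      · refine ⟨k + 1, l, sp j r r₀, hreach, ?_⟩
        simp only [bare, bareRight, load]
        by_cases hj0 : m j = 0
        · by_cases hr0 : r₀.load = 0
          · have hb : r.bareRight = 0 := by
              by_contra hcon
              exact hmerge ⟨⟨hj0, hr0⟩, by omega⟩
            simp only [hj0, hr0, true_and, if_true, zero_add, add_zero, and_self]
            rw [if_pos hpos]
            split_ifs <;> omega
          · simp only [hj0, hr0, true_and, if_true, and_false, if_false]
            rw [if_pos (by omega)]
            split_ifs <;> omega
        · simp only [hj0, false_and, if_false]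
          omega

/-- The number of spine vertices with legs. -/
def legged : CTree m → ℕ
  | nil => 0
  | leg _ t => t.legged
  | sp j l r => (if m j = 0 then 0 else 1) + l.legged + r.legged

theorem load_eq (t : CTree m) : t.load = t.legCount + t.legged := by
  induction t with
  | nil => rfl
  | leg a t ih => simp only [load, legCount, legged, ih]; omega
  | sp j l r ihl ihr => simp only [load, legCount, legged, ihl, ihr]; omega

theorem Valid.legged_le (h : t.Valid lo hi A) : t.legged ≤ weight m lo hi := by
  induction t generalizing lo hi A with
  | nil => simp [legged]
  | leg a t ih => exact ih h.2.2.2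
  | sp j l r ihl ihr =>
    obtain ⟨h1, h2, h3, h4⟩ := h
    have := ihl h3
    have := ihr h4
    rw [weight_split h1 h2, legsAt_fin]
    simp only [legged]
    split_ifs <;> omega

theorem Valid.legCount_le_ncard (h : t.Valid lo hi A) :
    t.legCount ≤ {a ∈ A | lo ≤ (a.1 : ℕ) ∧ (a.1 : ℕ) < hi}.ncard := by
  induction t generalizing lo hi A with
  | nil => simp [legCount]
  | leg a t ih =>
    obtain ⟨h1, h2, h3, h4⟩ := h
    have h5 := ih h4
    have h6 : {b ∈ A \ {a} | lo ≤ (b.1 : ℕ) ∧ (b.1 : ℕ) < hi} =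
        {b ∈ A | lo ≤ (b.1 : ℕ) ∧ (b.1 : ℕ) < hi} \ {a} := by
      ext b
      simp only [Set.mem_ofPred_eq, Set.mem_sdiff, Set.mem_singleton_iff]
      tauto
    rw [h6] at h5
    have := Set.ncard_sdiff_singleton_add_one
      (s := {b ∈ A | lo ≤ (b.1 : ℕ) ∧ (b.1 : ℕ) < hi}) (a := a) ⟨h3, h1, h2⟩ (Set.toFinite _)
    simp only [legCount]
    omega
  | sp j l r ihl ihr =>
    obtain ⟨h1, h2, h3, h4⟩ := h
    have h5 := ihl h3
    have h6 := ihr h4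
    have hdisj : Disjoint {a ∈ A | lo ≤ (a.1 : ℕ) ∧ (a.1 : ℕ) < j}
        {a ∈ A | (j : ℕ) + 1 ≤ (a.1 : ℕ) ∧ (a.1 : ℕ) < hi} := by
      rw [Set.disjoint_left]
      rintro a ⟨-, -, h⟩ ⟨-, h', -⟩
      omega
    have h7 := Set.ncard_union_eq hdisj (Set.toFinite _) (Set.toFinite _)
    have h8 := Set.ncard_le_ncard (s := {a ∈ A | lo ≤ (a.1 : ℕ) ∧ (a.1 : ℕ) < j} ∪
        {a ∈ A | (j : ℕ) + 1 ≤ (a.1 : ℕ) ∧ (a.1 : ℕ) < hi})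
        (t := {a ∈ A | lo ≤ (a.1 : ℕ) ∧ (a.1 : ℕ) < hi}) (by
      rintro a (⟨h, h', h''⟩ | ⟨h, h', h''⟩)
      · exact ⟨h, h', by omega⟩
      · exact ⟨h, by omega, h''⟩) (Set.toFinite _)
    simp only [legCount]
    omega

theorem ncard_legs_le (lo hi : ℕ) :
    {a : (i : Fin n) × Fin (m i) | lo ≤ (a.1 : ℕ) ∧ (a.1 : ℕ) < hi}.ncard ≤ weight m lo hi := by
  classical
  have hset : {a : (i : Fin n) × Fin (m i) | lo ≤ (a.1 : ℕ) ∧ (a.1 : ℕ) < hi} =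
      ((Finset.univ.filter fun a : (i : Fin n) × Fin (m i) =>
        lo ≤ (a.1 : ℕ) ∧ (a.1 : ℕ) < hi : Finset _) : Set _) := by
    ext a; simp
  rw [hset, Set.ncard_coe_finset, weight,
    Finset.card_eq_sum_card_fiberwise (f := fun a => (a.1 : ℕ)) (t := Finset.Ico lo hi)]
  · refine Finset.sum_le_sum fun i _ => ?_
    rw [← length_legList]
    refine le_trans (Finset.card_le_card ?_) (List.toFinset_card_le _)
    intro a ha
    simp only [Finset.mem_filter] at ha
    obtain ⟨-, rfl⟩ := ha
    rw [List.mem_toFinset, legList, dif_pos a.1.2]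
    exact List.mem_map.2 ⟨a.2, List.mem_finRange _, rfl⟩
  · intro a ha
    simpa using ha

theorem Valid.legCount_le (h : t.Valid lo hi A) : t.legCount ≤ weight m lo hi :=
  h.legCount_le_ncard.trans <| (Set.ncard_le_ncard (fun _ ha => ha.2) (Set.toFinite _)).trans
    (ncard_legs_le lo hi)

theorem Valid.load_le (h : t.Valid lo hi A) : t.load ≤ 2 * weight m lo hi := by
  have := h.legCount_le
  have := h.legged_le
  rw [load_eq]
  omega

end CTree

/-! ### Reduction to the canonical comb along a reference tree. -/

namespace RefTree

/-- The sum over all nodes of the number of legs in their intervals. -/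
def totalWeight {n : ℕ} (m : Fin n → ℕ) : RefTree → ℕ → ℕ → ℕ
  | leaf, _, _ => 0
  | node x L R, lo, hi => weight m lo hi + L.totalWeight m lo x + R.totalWeight m (x + 1) hi

/-- All nodes of the tree are spine indices with legs. -/
def AllLegged {n : ℕ} (m : Fin n → ℕ) : RefTree → Prop
  | leaf => True
  | node x L R => 0 < legsAt m x ∧ L.AllLegged m ∧ R.AllLegged m

end RefTree

namespace CTree

variable {t t' s l r : CTree m} {lo mid hi : ℕ} {A B : Set ((i : Fin n) × Fin (m i))}

/-- At a node of weight w ≥ 1, the pivot costs at most 4w for the load and 2 ≤ 2w for the two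
indicators, whence the factor 6; the terms in `bare` telescope. Intervals of weight zero have no
explicit legs left. -/
theorem Valid.exists_reach_legCount_eq_zero {P : RefTree} (hP : P.Valid m lo hi)
    (hP' : P.AllLegged m) (h : t.Valid lo hi A) : ∃ k t', Reach k t t' ∧ t'.legCount = 0 ∧
      k ≤ 6 * P.totalWeight m lo hi + 2 * t.bare := by
  induction P generalizing lo hi A t with
  | leaf =>
    have h1 : weight m lo hi = 0 := hP
    have := h.legCount_le
    exact ⟨0, t, .refl t, by omega, by omega⟩
  | node x L R ihL ihR =>
    obtain ⟨h1, h2, h3, h4⟩ := hP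
    obtain ⟨h5, h6, h7⟩ := hP'
    have hxn : x < n := by
      by_contra hcon
      simp [legsAt, hcon] at h5
    have hw := weight_split (m := m) h1 h2
    have h5' : 0 < m ⟨x, hxn⟩ := legsAt_fin (m := m) ⟨x, hxn⟩ ▸ h5
    obtain ⟨k, l, r, hk, hle⟩ := h.exists_reach_root (x := ⟨x, hxn⟩) h1 h2 h5'
    obtain ⟨-, -, hlv, hrv⟩ := hk.valid h
    obtain ⟨k₁, l', hk₁, hl', hle₁⟩ := ihL h3 h6 hlv
    obtain ⟨k₂, r', hk₂, hr', hle₂⟩ := ihR h4 h7 hrv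
    refine ⟨k + k₁ + k₂, sp ⟨x, hxn⟩ l' r',
      (hk.trans (hk₁.congr_left _ _)).trans (hk₂.congr_right _ _), by simp [legCount, hl', hr'], ?_⟩
    have := h.load_le
    have := bareLeft_le l
    have := bareRight_le r
    simp only [RefTree.totalWeight]
    omega

theorem rightLength_le_size (t : CTree m) : t.rightLength ≤ t.size := by
  induction t with
  | nil => simp [rightLength]
  | leg a t ih => simpa [rightLength, size] using ih
  | sp j l r ihl ihr => simp only [rightLength, size]; omega

/-- Each right rotation on the rightmost path lengthens it by one. The measure also drops when
passing to the right subtree, where the size and the path length both fall by one. -/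
theorem Valid.exists_reach_isComb (N : ℕ) : ∀ {t : CTree m} {lo : ℕ},
    2 * t.size - t.rightLength ≤ N → t.Valid lo hi A →
    t.legCount = 0 → ∃ k t', Reach k t t' ∧ t'.IsComb ∧ k ≤ t.size - t.rightLength := by
  induction N with
  | zero =>
    intro t lo hN h h0
    cases t with
    | nil => exact ⟨0, nil, .refl _, .nil, by omega⟩
    | leg a t => simp [legCount] at h0
    | sp j l r =>
      have := rightLength_le_size r
      simp only [rightLength, size] at hN
      omega
  | succ N ih =>
    intro t lo hN h h0
    cases t with
    | nil => exact ⟨0, nil, .refl _, .nil, by omega⟩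
    | leg a t => simp [legCount] at h0
    | sp j l r =>
      have hrs := rightLength_le_size r
      simp only [legCount, Nat.add_eq_zero_iff] at h0
      cases l with
      | nil =>
        simp only [rightLength, size] at hN ⊢
        obtain ⟨k, r', hk, hr', hle⟩ := ih (by omega) h.2.2.2 h0.2
        exact ⟨k, sp j nil r', hk.congr_right j nil, .sp j r' hr', by omega⟩
      | leg a l => simp [legCount] at h0
      | sp c l₁ l₂ =>
        have hc : c < j := h.2.2.1.2.1
        have hm := move_rotate_right hc l₁ l₂ r
        simp only [legCount, Nat.add_eq_zero_iff] at h0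
        obtain ⟨k, t', hk, ht', hle⟩ := ih (t := sp c l₁ (sp j l₂ r))
          (by simp only [rightLength, size] at hN ⊢; omega) (hm.2 _ _ _ h)
          (by simp [legCount, h0])
        refine ⟨k + 1, t', .head hm hk, ht', ?_⟩
        simp only [rightLength, size] at hle ⊢
        omega

theorem IsComb.unique (h : t.IsComb) (h' : t'.IsComb) (hv : t.Valid lo hi A)
    (hv' : t'.Valid lo hi B) : t = t' := by
  induction h generalizing lo t' with
  | nil =>
    have : hi ≤ lo := hv
    cases h' with
    | nil => rfl
    | sp j r h => have := hv'.1; have := hv'.2.1; omega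
  | sp j r _ ih =>
    obtain ⟨h1, h2, h3, h4⟩ := hv
    have h3' : (j : ℕ) ≤ lo := h3
    cases h' with
    | nil => have : hi ≤ lo := hv'; omega
    | sp j' r' hr' =>
      obtain ⟨h1', h2', h3', h4'⟩ := hv'
      have h3'' : (j' : ℕ) ≤ lo := h3'
      obtain rfl : j = j' := Fin.ext (by omega)
      rw [ih hr' h4 h4']

theorem edist_le (hn : 0 < n) {P : RefTree} (hP : P.Valid m 0 n) (hP' : P.AllLegged m)
    (T T' : (caterpillar m).SearchTree) : (caterpillar m).rotationGraph.edist T T' ≤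
      ((2 * (6 * P.totalWeight m 0 n + 3 * n) : ℕ) : ℕ∞) := by
  have key : ∀ T : (caterpillar m).SearchTree, ∃ (S : (caterpillar m).SearchTree) (s : CTree m)
      (w : (caterpillar m).rotationGraph.Walk T S), s.IsComb ∧ Rep S s ∧
        w.length ≤ 6 * P.totalWeight m 0 n + 3 * n := by
    intro T
    obtain ⟨t, ht⟩ := exists_rep T
    obtain ⟨k, s, hk, hs, hle⟩ := ht.1.exists_reach_legCount_eq_zero hP hP'
    obtain ⟨k', s', hk', hs', hle'⟩ := Valid.exists_reach_isComb _ le_rfl (hk.valid ht.1) hs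
    obtain ⟨S, w, hS, hw⟩ := (hk.trans hk').exists_walk hn ht
    -- The term `3 * n` consists of 2n for `2 * bare` and n for straightening.
    refine ⟨S, s', w, hs', hS, ?_⟩
    have := t.bare_le_size
    have := ht.1.size_le
    have := (hk.valid ht.1).size_le
    omega
  obtain ⟨S, s, w, hs, hS, hle⟩ := key T
  obtain ⟨S', s', w', hs', hS', hle'⟩ := key T'
  obtain rfl := hs.unique hs' hS.1 hS'.1
  obtain rfl := hS.unique hS'
  refine (SimpleGraph.Walk.edist_le (w.append w'.reverse)).trans ?_
  rw [SimpleGraph.Walk.length_append, SimpleGraph.Walk.length_reverse]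
  exact_mod_cast (by omega : w.length + w'.length ≤ _)

theorem ediam_le (hn : 0 < n) {P : RefTree} (hP : P.Valid m 0 n) (hP' : P.AllLegged m) :
    (caterpillar m).rotationGraph.ediam ≤ ((2 * (6 * P.totalWeight m 0 n + 3 * n) : ℕ) : ℕ∞) :=
  SimpleGraph.ediam_le_of_edist_le (edist_le hn hP hP')

end CTree

/-! ### Weighted medians and entropy estimates. -/

/-- The least index at which the prefix weight reaches half of the total; the prefix jumps there, so
it carries legs. -/
theorem exists_median {lo hi : ℕ} (hlt : lo < hi) (h : 0 < weight m lo hi) :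
    ∃ x, lo ≤ x ∧ x < hi ∧ 0 < legsAt m x ∧ 2 * weight m lo x ≤ weight m lo hi ∧
      2 * weight m (x + 1) hi ≤ weight m lo hi := by
  have hex : ∃ y, weight m lo hi ≤ 2 * weight m lo (y + 1) :=
    ⟨hi - 1, by rw [Nat.sub_add_cancel (by omega)]; omega⟩
  classical
  obtain ⟨x, hx, hmin⟩ : ∃ x, weight m lo hi ≤ 2 * weight m lo (x + 1) ∧
      ∀ y < x, 2 * weight m lo (y + 1) < weight m lo hi :=
    ⟨Nat.find hex, Nat.find_spec hex, fun y hy => not_le.1 (Nat.find_min hex hy)⟩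
  have hlox : lo ≤ x := by
    by_contra hcon
    have : weight m lo (x + 1) = 0 := by
      rw [weight, Finset.Ico_eq_empty_of_le (by omega), Finset.sum_empty]
    omega
  have hxhi : x < hi := by
    by_contra hcon
    have := hmin (hi - 1) (by omega)
    rw [Nat.sub_add_cancel (by omega)] at this
    omega
  have hleft : 2 * weight m lo x < weight m lo hi := by
    rcases hlox.eq_or_lt with rfl | hlox
    · rw [weight_self]; omega
    · have := hmin (x - 1) (by omega)
      rwa [Nat.sub_add_cancel (by omega)] at this
  have h1 := weight_split (m := m) hlox hxhi
  have h2 := weight_split (m := m) hlox (Nat.lt_succ_self x)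
  rw [Nat.succ_eq_add_one, weight_self] at h2
  exact ⟨x, hlox, hxhi, by omega, hleft.le, by omega⟩

/-- The number of legs with index in `[lo, hi)`, times the entropy of their distribution. -/
noncomputable def entropyOn {n : ℕ} (m : Fin n → ℕ) (lo hi : ℕ) : ℝ :=
  (weight m lo hi : ℝ) * Real.log (weight m lo hi) -
    ∑ i ∈ Finset.Ico lo hi, (legsAt m i : ℝ) * Real.log (legsAt m i)

theorem entropyOn_split {lo hi x : ℕ} (h1 : lo ≤ x) (h2 : x < hi) :
    entropyOn m lo hi = entropyOn m lo x + entropyOn m (x + 1) hi +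
      ((weight m lo hi : ℝ) * Real.log (weight m lo hi) -
        (weight m lo x : ℝ) * Real.log (weight m lo x) -
        (weight m (x + 1) hi : ℝ) * Real.log (weight m (x + 1) hi) -
        (legsAt m x : ℝ) * Real.log (legsAt m x)) := by
  unfold entropyOn
  rw [← Finset.sum_Ico_consecutive _ h1 h2.le, Finset.sum_eq_sum_Ico_succ_bot h2]
  ring

theorem entropyOn_of_weight_eq_zero {lo hi : ℕ} (h : weight m lo hi = 0) :
    entropyOn m lo hi = 0 := by
  unfold entropyOn
  rw [h, Finset.sum_eq_zero]
  · simp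
  · intro i hi
    rw [Finset.mem_Ico] at hi
    rw [weight_eq_zero h hi.1 hi.2]
    simp

theorem mul_log_le {a w : ℝ} (ha : 0 ≤ a) (h : a ≤ w) : a * Real.log a ≤ a * Real.log w := by
  rcases ha.eq_or_lt with rfl | ha
  · simp
  · exact mul_le_mul_of_nonneg_left (Real.log_le_log ha h) ha.le

/-- Replace log a and log b by log (w/2), and log c by log w. -/
theorem add_mul_log_two_le {a b c w : ℝ} (ha : 0 ≤ a) (hb : 0 ≤ b) (hc : 0 ≤ c)
    (hw : w = a + b + c) (h1 : 2 * a ≤ w) (h2 : 2 * b ≤ w) : (a + b) * Real.log 2 ≤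
      w * Real.log w - a * Real.log a - b * Real.log b - c * Real.log c := by
  rcases (by positivity : 0 ≤ a + b + c).eq_or_lt with h0 | h0
  · obtain rfl : a = 0 := by linarith
    obtain rfl : b = 0 := by linarith
    obtain rfl : c = 0 := by linarith
    simp [hw]
  · rw [← hw] at h0
    have hlog : Real.log (w / 2) = Real.log w - Real.log 2 :=
      Real.log_div h0.ne' two_ne_zero
    have ha' := mul_log_le ha (by linarith : a ≤ w / 2)
    have hb' := mul_log_le hb (by linarith : b ≤ w / 2)
    have hc' := mul_log_le hc (by linarith : c ≤ w)
    rw [hlog] at ha' hb'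
    have : w * Real.log w = a * Real.log w + b * Real.log w + c * Real.log w := by rw [hw]; ring
    linarith

/-- The convex function x log x lies above its tangent at `w`. -/
theorem mul_log_ge {a w : ℝ} (ha : 0 ≤ a) (hw : 0 < w) :
    a * Real.log w + a - w ≤ a * Real.log a := by
  rcases ha.eq_or_lt with rfl | ha
  · simp [hw.le]
  · have h := Real.one_sub_inv_le_log_of_pos (div_pos ha hw)
    rw [Real.log_div ha.ne' hw.ne', inv_div] at h
    have h' := mul_le_mul_of_nonneg_left h ha.le
    have : a * (1 - w / a) = a - w := by field_simp
    linarith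

/-- The three tangent bounds at w/3 are added; their terms without logarithm cancel. -/
theorem le_mul_log_three {a b c w : ℝ} (ha : 0 ≤ a) (hb : 0 ≤ b) (hc : 0 ≤ c)
    (hw : w = a + b + c) (h0 : 0 < w) :
    w * Real.log w - a * Real.log a - b * Real.log b - c * Real.log c ≤ w * Real.log 3 := by
  have h3 : 0 < w / 3 := by positivity
  have hlog : Real.log (w / 3) = Real.log w - Real.log 3 := Real.log_div h0.ne' three_ne_zero
  have ha' := mul_log_ge ha h3
  have hb' := mul_log_ge hb h3
  have hc' := mul_log_ge hc h3
  rw [hlog] at ha' hb' hc'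
  have h1 : w * Real.log w = a * Real.log w + b * Real.log w + c * Real.log w := by rw [hw]; ring
  have h2 : w * Real.log 3 = a * Real.log 3 + b * Real.log 3 + c * Real.log 3 := by rw [hw]; ring
  linarith

/-- The weighted-median reference tree. -/
theorem exists_refTree (k : ℕ) : ∀ lo hi : ℕ, hi - lo ≤ k → ∃ P : RefTree, P.Valid m lo hi ∧
    P.AllLegged m ∧
    Real.log 2 * P.totalWeight m lo hi ≤ entropyOn m lo hi + weight m lo hi * Real.log 2 ∧
    entropyOn m lo hi ≤ 2 * Real.log 3 * (P.score m lo hi + weight m lo hi) := by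
  have leaf : ∀ lo hi : ℕ, weight m lo hi = 0 → ∃ P : RefTree, P.Valid m lo hi ∧
      P.AllLegged m ∧
      Real.log 2 * P.totalWeight m lo hi ≤ entropyOn m lo hi + weight m lo hi * Real.log 2 ∧
      entropyOn m lo hi ≤ 2 * Real.log 3 * (P.score m lo hi + weight m lo hi) := by
    intro lo hi h
    refine ⟨.leaf, h, trivial, ?_, ?_⟩ <;>
      simp [entropyOn_of_weight_eq_zero h, RefTree.totalWeight, RefTree.score, h]
  induction k with
  | zero =>
    intro lo hi hk
    apply leaf
    rw [weight, Finset.Ico_eq_empty_of_le (by omega), Finset.sum_empty]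
  | succ k ih =>
    intro lo hi hk
    rcases Nat.eq_zero_or_pos (weight m lo hi) with h0 | h0
    · exact leaf lo hi h0
    have hlt : lo < hi := by
      by_contra hcon
      rw [weight, Finset.Ico_eq_empty_of_le (by omega), Finset.sum_empty] at h0
      omega
    obtain ⟨x, h1, h2, h3, h4, h5⟩ := exists_median hlt h0
    obtain ⟨L, hL1, hL2, hL3, hL4⟩ := ih lo x (by omega)
    obtain ⟨R, hR1, hR2, hR3, hR4⟩ := ih (x + 1) hi (by omega)
    have hw := weight_split (m := m) h1 h2
    -- The heavier side has at most half of the weight, so the lighter side together with `x` has at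
    -- least half. The legs at `x` are charged to the weight term, since the `legsAt` values add up
    -- to it.
    have hmin : weight m lo hi ≤
        2 * (min (weight m lo x) (weight m (x + 1) hi) + legsAt m x) := by omega
    have hw' : (weight m lo hi : ℝ) = weight m lo x + weight m (x + 1) hi + legsAt m x := by
      rw [hw]; push_cast; ring
    have hsplit := entropyOn_split (m := m) h1 h2
    have hlow := add_mul_log_two_le (Nat.cast_nonneg (weight m lo x))
      (Nat.cast_nonneg (weight m (x + 1) hi)) (Nat.cast_nonneg (legsAt m x)) hw'
      (by exact_mod_cast h4) (by exact_mod_cast h5)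
    have hup := le_mul_log_three (Nat.cast_nonneg (weight m lo x))
      (Nat.cast_nonneg (weight m (x + 1) hi)) (Nat.cast_nonneg (legsAt m x)) hw'
      (by exact_mod_cast h0)
    have hlog3 : 0 < Real.log 3 := Real.log_pos (by norm_num)
    have hlog2 : 0 < Real.log 2 := Real.log_pos (by norm_num)
    refine ⟨.node x L R, ⟨h1, h2, hL1, hR1⟩, ⟨h3, hL2, hR2⟩, ?_, ?_⟩
    · rw [hsplit]
      simp only [RefTree.totalWeight, Nat.cast_add, mul_add]
      linarith
    · rw [hsplit]
      simp only [RefTree.score, Nat.cast_add]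
      have hmin' : (weight m lo hi : ℝ) ≤
          2 * (((min (weight m lo x) (weight m (x + 1) hi) : ℕ) : ℝ) + legsAt m x) := by
        exact_mod_cast hmin
      have := mul_le_mul_of_nonneg_right hmin' hlog3.le
      have e : 2 * Real.log 3 * ((((min (weight m lo x) (weight m (x + 1) hi) : ℕ) : ℝ) +
          L.score m lo x + R.score m (x + 1) hi) + weight m lo hi) =
          2 * (((min (weight m lo x) (weight m (x + 1) hi) : ℕ) : ℝ) + legsAt m x) * Real.log 3 +
          2 * Real.log 3 * (L.score m lo x + weight m lo x) +
          2 * Real.log 3 * (R.score m (x + 1) hi + weight m (x + 1) hi) := by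
        rw [hw']; ring
      linarith

theorem weight_mul_legEntropy :
    ((∑ i, m i : ℕ) : ℝ) * legEntropy m = entropyOn m 0 n := by
  rcases Nat.eq_zero_or_pos (∑ i, m i) with h0 | h0
  · rw [entropyOn_of_weight_eq_zero (weight_zero_n.trans h0), h0]
    simp
  · have h0' : ((∑ i, m i : ℕ) : ℝ) ≠ 0 := by exact_mod_cast h0.ne'
    have hterm : ∀ i : Fin n, (if 0 < m i then ((∑ i, m i : ℕ) : ℝ) *
        (((m i : ℝ) / (∑ j, m j : ℕ)) * Real.log ((∑ j, m j : ℕ) / (m i : ℝ))) else 0) =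
        (m i : ℝ) * Real.log (∑ j, m j : ℕ) - (m i : ℝ) * Real.log (m i) := by
      intro i
      split_ifs with hi
      · have hi' : (m i : ℝ) ≠ 0 := by exact_mod_cast hi.ne'
        rw [Real.log_div h0' hi', ← mul_assoc, mul_div_cancel₀ _ h0']
        ring
      · have : m i = 0 := by omega
        simp [this]
    rw [legEntropy, Finset.mul_sum, Finset.sum_filter, Finset.sum_congr rfl fun i _ => hterm i,
      Finset.sum_sub_distrib, ← Finset.sum_mul, entropyOn, weight_zero_n, ← Finset.range_eq_Ico,
      ← Fin.sum_univ_eq_sum_range (fun i => (legsAt m i : ℝ) * Real.log (legsAt m i))]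
    simp

end Caterpillar

/-! ### The theorem. -/

theorem theorem1 :
    ∃ c C : ℝ, 0 < c ∧ 0 < C ∧
      ∀ (n : ℕ) (m : Fin n → ℕ), 1 ≤ n →
        (caterpillar m).rotationGraph.ediam ≠ ⊤ ∧
        ((caterpillar m).rotationGraph.diam : ℝ) ≤
          C * ((n : ℝ) + ((∑ i, m i : ℕ) : ℝ) * (legEntropy m + 1)) ∧
        (2 ≤ n + ∑ i, m i →
          c * ((n : ℝ) + ((∑ i, m i : ℕ) : ℝ) * (legEntropy m + 1)) ≤
            ((caterpillar m).rotationGraph.diam : ℝ)) := by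
  -- Write d for the diameter, E = mH and W for `totalWeight`. For 24: d ≤ 12W + 6n and W ≤ 2(E +
  -- m). For 1/31: n ≤ 2d, m ≤ d, and E ≤ 4(score + m) ≤ 4(6d + d) = 28d.
  refine ⟨1 / 31, 24, by norm_num, by norm_num, fun n m hn => ?_⟩
  obtain ⟨P, hP, hP', htw, hscore⟩ := Caterpillar.exists_refTree (m := m) n 0 n (by omega)
  have hediam := Caterpillar.CTree.ediam_le hn hP hP'
  have hfin : (caterpillar m).rotationGraph.ediam ≠ ⊤ :=
    ne_top_of_le_ne_top (ENat.natCast_ne_top _) hediam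
  rw [Caterpillar.weight_zero_n, ← Caterpillar.weight_mul_legEntropy] at htw hscore
  set w : ℕ := ∑ i, m i with hw
  set E : ℝ := (w : ℝ) * legEntropy m with hE
  have hexp : (n : ℝ) + (w : ℝ) * (legEntropy m + 1) = n + E + w := by rw [hE]; ring
  have hlog2 : 1 / 2 ≤ Real.log 2 := by have := Real.log_two_gt_d9; linarith
  have hlog2' : Real.log 2 ≤ 1 := by have := Real.log_two_lt_d9; linarith
  have hlog3 : Real.log 3 ≤ 2 := by
    have := Real.log_le_sub_one_of_pos (show (0 : ℝ) < 3 by norm_num)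
    linarith
  have hw0 : (0 : ℝ) ≤ w := Nat.cast_nonneg _
  have hn0 : (0 : ℝ) ≤ n := Nat.cast_nonneg _
  rw [hexp]
  refine ⟨hfin, ?_, fun h2 => ?_⟩
  · have hd : (caterpillar m).rotationGraph.diam ≤ 2 * (6 * P.totalWeight m 0 n + 3 * n) :=
      ENat.toNat_le_of_le_natCast hediam
    have hd' : ((caterpillar m).rotationGraph.diam : ℝ) ≤
        2 * (6 * (P.totalWeight m 0 n : ℝ) + 3 * n) := by exact_mod_cast hd
    have h1 : (P.totalWeight m 0 n : ℝ) * (1 / 2) ≤ Real.log 2 * P.totalWeight m 0 n := by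
      rw [mul_comm]
      exact mul_le_mul_of_nonneg_right hlog2 (Nat.cast_nonneg _)
    have h3 := mul_le_mul_of_nonneg_left hlog2' hw0
    linarith
  · have hs := Caterpillar.CTree.score_le_diam hn hfin hP
    have hwd := Caterpillar.CTree.weight_le_diam hn hfin hP
    have hnd := Caterpillar.CTree.spine_le_diam hn hfin
    set d := (caterpillar m).rotationGraph.diam
    -- For n ≥ 2 this is n ≤ d + 1 ≤ 2d; for n = 1 there is a leg, so d ≥ 1.
    have hn2 : n ≤ 2 * d := by omega
    have hs' : (P.score m 0 n : ℝ) ≤ 2 * n + 2 * d := by exact_mod_cast hs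
    have hwd' : (w : ℝ) ≤ d := by exact_mod_cast hwd
    have hn2' : (n : ℝ) ≤ 2 * d := by exact_mod_cast hn2
    have h1 : 2 * Real.log 3 * ((P.score m 0 n : ℝ) + w) ≤ 4 * ((P.score m 0 n : ℝ) + w) :=
      mul_le_mul_of_nonneg_right (by linarith) (by positivity)
    linarith
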